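/- Let $d\ge 2$, let $\mathbb S=S^{d-1}\subset\mathbb R^d$ be the unit sphere with its surface measure $dS$, and let $c_d=\sqrt{\pi}/(2\pi)^{d/2}$. For $\varphi\in L_2(\mathbb S)$ put $$(\mathbf I\varphi)(x)=c_d\int_{\mathbb S}\varphi(\xi)e^{ix\cdot\xi}\,dS(\xi),\qquad x\in\mathbb R^d,$$ and let $\mathcal H=\mathbf I(L_2(\mathbb S))$ be the Hilbert space of Herglotz solutions of the Helmholtz equation $\Delta u+u=0$, with the norm $\|\mathbf I\varphi\|=\|\varphi\|_{L_2(\mathbb S)}$, so that $\mathbf I:L_2(\mathbb S)\to\mathcal H$ is unitary. Let $a\in\mathcal E'(\mathbb R^d)$ be a distribution with compact support, that is, a continuous linear functional on $\mathcal E(\mathbb R^d)=C^\infty(\mathbb R^d)$, and let $\widehat a(\zeta)=(2\pi)^{-d/2}\,(a,e^{-ix\cdot\zeta})$ be its Fourier transform. Then there is exactly one bounded operator $T_a$ on $\mathcal H$ (the Toeplitz operator with symbol $a$) with $$\langle T_a u,v\rangle=(a,u\overline v)\qquad\text{for all }u,v\in\mathcal H .$$ The operator $T_a$ is compact. Moreover,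 it belongs to every Schatten class $\mathfrak S_p$, $0<p<\infty$: $\sum_n s_n(T_a)^p<\infty$, where $s_n(T_a)$ are the singular values of $T_a$ (the square roots of the nonzero eigenvalues of $T_a^*T_a$) counted with multiplicities. Finally, $\widehat a$ is a $C^\infty$ function on $\mathbb R^d$, and $\breve T_a=\mathbf I^{-1}T_a\mathbf I$ is the integral operator on $L_2(\mathbb S)$ with smooth kernel given, for every $\varphi\in L_2(\mathbb S)$ and almost every $\eta\in\mathbb S$, by $$(\breve T_a\varphi)(\eta)=\frac{\pi}{(2\pi)^{d/2}}\int_{\mathbb S}\widehat a(\eta-\xi)\varphi(\xi)\,dS(\xi).$$ -/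

import Mathlib

open MeasureTheory
open scoped ContDiff ComplexConjugate

noncomputable section

namespace Helmholtz

/-! ### The sphere and Herglotz functions -/

/-- The Euclidean space `ℝ^d`. -/
abbrev E (d : ℕ) : Type := EuclideanSpace ℝ (Fin d)

/-- The unit sphere of `ℝ^d`. -/
abbrev S (d : ℕ) : Type := Metric.sphere (0 : E d) 1

/-- The surface measure on the unit sphere (not normalized: its total mass is the area). -/
def surf (d : ℕ) : Measure (S d) := (volume : Measure (E d)).toSphere

instance (d : ℕ) : IsFiniteMeasure (surf d) := by unfold surf; infer_instance

/-- `L₂` of the unit sphere with respect to surface measure. -/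
abbrev L2S (d : ℕ) : Type := Lp ℂ 2 (surf d)

/-- The constant `c_d = √π / (2π)^{d/2}`. -/
def cd (d : ℕ) : ℝ := Real.sqrt Real.pi / (2 * Real.pi) ^ ((d : ℝ) / 2)

lemma cd_pos (d : ℕ) : 0 < cd d := by unfold cd; positivity

/-- The function `(I φ)(x) = c_d ∫_S φ(ξ) e^{i x·ξ} dS(ξ)`. -/
def herglotzFun {d : ℕ} (φ : S d → ℂ) (x : E d) : ℂ :=
  (cd d : ℂ) * ∫ ξ : S d, φ ξ * Complex.exp (Complex.I * (inner ℝ x (ξ : E d) : ℝ)) ∂(surf d)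

/-- The character `ξ ↦ e^{i x·ξ}` as a continuous function on the sphere. -/
def sphereChar {d : ℕ} (x : E d) : C(S d, ℂ) :=
  ⟨fun ξ => Complex.exp (Complex.I * (inner ℝ x (ξ : E d) : ℝ)), by fun_prop⟩

lemma integrable_coe {d : ℕ} (φ : L2S d) : Integrable φ (surf d) :=
  (Lp.memLp φ).integrable (by norm_num)

lemma integrable_mul_char {d : ℕ} (φ : L2S d) (x : E d) :
    Integrable (fun ξ : S d => φ ξ * Complex.exp (Complex.I * (inner ℝ x (ξ : E d) : ℝ)))
      (surf d) := by
  refine (integrable_coe φ).mul_bdd (c := 1) (sphereChar x).continuous.aestronglyMeasurable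
    (Filter.Eventually.of_forall fun ξ => ?_)
  change ‖Complex.exp (Complex.I * (inner ℝ x (ξ : E d) : ℝ))‖ ≤ 1
  rw [mul_comm, Complex.norm_exp_ofReal_mul_I]

/-- The linear map `φ ↦ I φ` from `L₂(S)` to functions on `ℝ^d`. -/
def herglotzMap (d : ℕ) : L2S d →ₗ[ℂ] (E d → ℂ) where
  toFun φ := herglotzFun φ
  map_add' φ ψ := by
    funext x
    simp only [herglotzFun, Pi.add_apply]
    rw [← mul_add, ← integral_add (integrable_mul_char φ x) (integrable_mul_char ψ x)]
    congr 1
    refine integral_congr_ae ?_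
    filter_upwards [Lp.coeFn_add φ ψ] with ξ h
    rw [h, Pi.add_apply, add_mul]
  map_smul' c φ := by
    funext x
    simp only [herglotzFun, Pi.smul_apply, RingHom.id_apply, smul_eq_mul]
    rw [mul_left_comm]
    refine congrArg ((cd d : ℂ) * ·) ((integral_congr_ae ?_).trans (integral_const_mul c _))
    filter_upwards [Lp.coeFn_smul c φ] with ξ h
    rw [h, Pi.smul_apply, smul_eq_mul, mul_assoc]

lemma herglotzFun_contDiff {d : ℕ} (φ : L2S d) : ContDiff ℝ ∞ (herglotzFun (φ : S d → ℂ)) := by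
  have hemb : MeasurableEmbedding (Subtype.val : S d → E d) :=
    MeasurableEmbedding.subtype_coe Metric.isClosed_sphere.measurableSet
  let L : E d →L[ℝ] E d →L[ℝ] ℝ := (-(2 * Real.pi)⁻¹) • innerSL ℝ
  let g : E d → ℂ := Function.extend Subtype.val (φ : S d → ℂ) 0
  have hg : ∀ ξ : S d, g ξ = φ ξ := fun ξ => Subtype.val_injective.extend_apply _ _ ξ
  have key : herglotzFun (φ : S d → ℂ) = fun x => (cd d : ℂ) *
      VectorFourier.fourierIntegral Real.fourierChar ((surf d).map Subtype.val)
        L.toLinearMap₁₂ g x := by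
    funext x
    simp only [herglotzFun, VectorFourier.fourierIntegral]
    rw [hemb.integral_map]
    congr 1
    refine integral_congr_ae (Filter.Eventually.of_forall fun ξ => ?_)
    simp only [hg, Circle.smul_def, Real.fourierChar_apply, smul_eq_mul]
    rw [mul_comm]
    have hL : L.toLinearMap₁₂ (ξ : E d) x = -(2 * Real.pi)⁻¹ * inner ℝ (ξ : E d) x := rfl
    rw [hL, real_inner_comm]
    congr 2
    push_cast
    have : (Real.pi : ℂ) ≠ 0 := by exact_mod_cast Real.pi_ne_zero
    field_simp
  rw [key]
  refine contDiff_const.mul (VectorFourier.contDiff_fourierIntegral (N := (⊤ : ℕ∞)) L ?_)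
  intro n _
  rw [hemb.integrable_map_iff]
  refine (integrable_coe φ).norm.congr (Filter.Eventually.of_forall fun ξ => ?_)
  simp [hg]

lemma span_sphereChar_dense (d : ℕ) :
    (Submodule.span ℂ (Set.range (sphereChar (d := d)))).topologicalClosure = ⊤ := by
  let M : Multiplicative (E d) →* C(S d, ℂ) :=
    { toFun := fun x => sphereChar x.toAdd
      map_one' := by ext ξ; simp [sphereChar]
      map_mul' := fun x y => by
        ext ξ
        simp [sphereChar, inner_add_left, mul_add, Complex.exp_add] }
  have hM : (MonoidHom.mrange M : Set C(S d, ℂ)) = Set.range (sphereChar (d := d)) := by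
    ext f
    constructor
    · rintro ⟨x, rfl⟩; exact ⟨x.toAdd, rfl⟩
    · rintro ⟨x, rfl⟩; exact ⟨Multiplicative.ofAdd x, rfl⟩
  let A : StarSubalgebra ℂ C(S d, ℂ) :=
    { Algebra.adjoin ℂ (Set.range (sphereChar (d := d))) with
      star_mem' := by
        intro f hf
        change star f ∈ Algebra.adjoin ℂ (Set.range (sphereChar (d := d)))
        change f ∈ Algebra.adjoin ℂ (Set.range (sphereChar (d := d))) at hf
        induction hf using Algebra.adjoin_induction with
        | mem f hf =>
          obtain ⟨x, rfl⟩ := hf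
          refine Algebra.subset_adjoin ⟨-x, ?_⟩
          ext ξ
          simp [sphereChar, ← Complex.exp_conj]
        | algebraMap r =>
          have : star (algebraMap ℂ C(S d, ℂ) r) = algebraMap ℂ C(S d, ℂ) (star r) := by
            ext ξ; simp
          rw [this]
          exact Subalgebra.algebraMap_mem _ _
        | add f g _ _ hf hg => rw [star_add]; exact add_mem hf hg
        | mul f g _ _ hf hg => rw [star_mul]; exact mul_mem hg hf }
  have hA : A.SeparatesPoints := by
    intro ξ η hne
    by_contra! H
    apply hne
    -- compare the two characters along the line spanned by the difference
    have hz : (ξ : E d) - η = 0 := by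
      by_contra hz
      set z : E d := (ξ : E d) - η
      have hz2 : 0 < ‖z‖ ^ 2 := by positivity
      have h1 := H (sphereChar ((‖z‖ ^ 2)⁻¹ • z))
        ⟨_, Algebra.subset_adjoin ⟨_, rfl⟩, rfl⟩
      simp only [sphereChar, ContinuousMap.coe_mk] at h1
      have h2 : Complex.exp (Complex.I * (inner ℝ ((‖z‖ ^ 2)⁻¹ • z) z : ℝ)) = 1 := by
        have : (inner ℝ ((‖z‖ ^ 2)⁻¹ • z) z : ℝ) = inner ℝ ((‖z‖ ^ 2)⁻¹ • z) (ξ : E d) -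
            inner ℝ ((‖z‖ ^ 2)⁻¹ • z) (η : E d) := by rw [← inner_sub_right]
        rw [this]
        push_cast
        rw [mul_sub, Complex.exp_sub, h1, div_self (Complex.exp_ne_zero _)]
      rw [real_inner_smul_left, real_inner_self_eq_norm_sq, inv_mul_cancel₀ hz2.ne'] at h2
      have h3 := congrArg Complex.re h2
      rw [mul_comm, Complex.exp_ofReal_mul_I_re, Complex.one_re] at h3
      linarith [Real.cos_one_le]
    exact Subtype.ext (sub_eq_zero.mp hz)
  have h1 := ContinuousMap.starSubalgebra_topologicalClosure_eq_top_of_separatesPoints A hA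
  have h2 : (A : Set C(S d, ℂ)) =
      (Submodule.span ℂ (Set.range (sphereChar (d := d))) : Set C(S d, ℂ)) := by
    change ((Algebra.adjoin ℂ (Set.range (sphereChar (d := d)))).toSubmodule : Set C(S d, ℂ)) = _
    rw [Algebra.adjoin_eq_span, ← hM, Submonoid.closure_eq]
  apply SetLike.coe_injective
  rw [Submodule.topologicalClosure_coe, ← h2, ← StarSubalgebra.topologicalClosure_coe, h1]
  rfl

lemma herglotzMap_injective (d : ℕ) : Function.Injective (herglotzMap d) := by
  rw [← LinearMap.ker_eq_bot, LinearMap.ker_eq_bot']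
  intro φ hφ
  have hdense := (ContinuousMap.toLp_denseRange ℂ (surf d) ℂ
    (p := 2) (by norm_num)).topologicalClosure_map_submodule (span_sphereChar_dense d)
  rw [Submodule.topologicalClosure_eq_top_iff] at hdense
  have : φ ∈ (Submodule.map (ContinuousMap.toLp 2 (surf d) ℂ).toLinearMap
      (Submodule.span ℂ (Set.range (sphereChar (d := d)))))ᗮ := by
    rw [Submodule.map_span, Submodule.mem_orthogonal]
    intro u hu
    induction hu using Submodule.span_induction with
    | mem u hu =>
      obtain ⟨_, ⟨x, rfl⟩, rfl⟩ := hu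
      have h0 : herglotzFun (φ : S d → ℂ) (-x) = 0 := congrFun hφ (-x)
      have hc : (cd d : ℂ) ≠ 0 := by exact_mod_cast (cd_pos d).ne'
      have h0' := (mul_eq_zero.mp h0).resolve_left hc
      rw [← h0', L2.inner_def]
      refine integral_congr_ae ?_
      filter_upwards [ContinuousMap.coeFn_toLp (p := 2) (𝕜 := ℂ) (surf d) (sphereChar x)] with ξ h
      simp only [ContinuousLinearMap.coe_coe]
      rw [h]
      simp [sphereChar, ← Complex.exp_conj]
    | zero => simp
    | add u v _ _ hu hv => rw [inner_add_left, hu, hv, add_zero]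
    | smul c u _ hu => rw [inner_smul_left, hu, mul_zero]
  rw [hdense] at this
  simpa using this

/-- The space `ℋ` of Herglotz solutions of the Helmholtz equation: the functions `I φ` on `ℝ^d`
with `φ ∈ L₂(S)`. (A type synonym, so that it does not carry the topology of pointwise
convergence.) -/
def Herglotz (d : ℕ) : Type := ↥(LinearMap.range (herglotzMap d))

namespace Herglotz

instance (d : ℕ) : AddCommGroup (Herglotz d) :=
  inferInstanceAs (AddCommGroup ↥(LinearMap.range (herglotzMap d)))

instance (d : ℕ) : Module ℂ (Herglotz d) :=
  inferInstanceAs (Module ℂ ↥(LinearMap.range (herglotzMap d)))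

instance (d : ℕ) : CoeFun (Herglotz d) (fun _ => E d → ℂ) := ⟨fun u => u.1⟩

/-- The map `I : φ ↦ I φ` as a linear bijection of `L₂(S)` onto `ℋ`. -/
def equiv (d : ℕ) : L2S d ≃ₗ[ℂ] Herglotz d :=
  LinearEquiv.ofInjective (herglotzMap d) (herglotzMap_injective d)

/-- The norm of `ℋ`, carried over from `L₂(S)`: `‖I φ‖ = ‖φ‖`. -/
instance (d : ℕ) : NormedAddCommGroup (Herglotz d) :=
  NormedAddCommGroup.induced (Herglotz d) (L2S d) (equiv d).symm (equiv d).symm.injective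

/-- The inner product of `ℋ`, carried over from `L₂(S)`: `⟨I φ, I ψ⟩ = ⟨φ, ψ⟩`. -/
instance (d : ℕ) : InnerProductSpace ℂ (Herglotz d) where
  norm_smul_le c u := (NormedSpace.induced ℂ (Herglotz d) (L2S d) (equiv d).symm).norm_smul_le c u
  inner u v := inner ℂ ((equiv d).symm u) ((equiv d).symm v)
  norm_sq_eq_re_inner u := norm_sq_eq_re_inner (𝕜 := ℂ) ((equiv d).symm u)
  conj_inner_symm u v := inner_conj_symm ((equiv d).symm u) ((equiv d).symm v)
  add_left u v w := by simp only [map_add, inner_add_left]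
  smul_left u v c := by simp only [map_smul, inner_smul_left]

/-- The unitary operator `I : L₂(S) → ℋ`. -/
def I (d : ℕ) : L2S d ≃ₗᵢ[ℂ] Herglotz d where
  toLinearEquiv := equiv d
  norm_map' φ := by
    change ‖(equiv d).symm (equiv d φ)‖ = ‖φ‖
    rw [LinearEquiv.symm_apply_apply]

lemma I_apply {d : ℕ} (φ : L2S d) : ((I d φ : Herglotz d) : E d → ℂ) = herglotzFun φ := rfl

instance (d : ℕ) : CompleteSpace (Herglotz d) :=
  ((I d).symm.isometry.isUniformInducing.completeSpace_congr (I d).symm.surjective).mpr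
    inferInstance

lemma contDiff {d : ℕ} (u : Herglotz d) : ContDiff ℝ ∞ u := by
  obtain ⟨φ, h⟩ := u.2
  rw [← h]
  exact herglotzFun_contDiff φ

end Herglotz

/-! ### Distributions with compact support -/

/-- The space of complex `C^∞` functions on `ℝ^d`, as a subspace of all functions. -/
def smoothSubmodule (d : ℕ) : Submodule ℂ (E d → ℂ) where
  carrier := {f | ContDiff ℝ ∞ f}
  add_mem' := fun {f g} (hf : ContDiff ℝ ∞ f) (hg : ContDiff ℝ ∞ g) => hf.add hg
  zero_mem' := show ContDiff ℝ ∞ (fun _ : E d => (0 : ℂ)) from contDiff_const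
  smul_mem' := fun c f (hf : ContDiff ℝ ∞ f) => hf.const_smul c

/-- The space `ℰ(ℝ^d) = C^∞(ℝ^d)` of smooth complex functions. (A type synonym, so that it does not
carry the topology of pointwise convergence.) -/
def Smooth (d : ℕ) : Type := ↥(smoothSubmodule d)

namespace Smooth

instance (d : ℕ) : AddCommGroup (Smooth d) := inferInstanceAs (AddCommGroup ↥(smoothSubmodule d))

instance (d : ℕ) : Module ℂ (Smooth d) := inferInstanceAs (Module ℂ ↥(smoothSubmodule d))

instance (d : ℕ) : CoeFun (Smooth d) (fun _ => E d → ℂ) := ⟨fun f => f.1⟩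

/-- The `k`-th derivative of a smooth function, as a continuous function. -/
def derivC {d : ℕ} (k : ℕ) (f : Smooth d) : C(E d, (E d) [×k]→L[ℝ] ℂ) :=
  ⟨iteratedFDeriv ℝ k f, ContDiff.continuous_iteratedFDeriv (mod_cast le_top)
    (show ContDiff ℝ ∞ (f : E d → ℂ) from f.2)⟩

/-- The topology of `ℰ(ℝ^d)`: uniform convergence on compact sets of all derivatives
(`C(X, Y)` carries the compact-open topology). -/
instance (d : ℕ) : TopologicalSpace (Smooth d) :=
  ⨅ k : ℕ, TopologicalSpace.induced (derivC k) inferInstance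

/-- The plane wave `x ↦ e^{-i x·ζ}`. -/
def planeWave {d : ℕ} (ζ : E d) : Smooth d :=
  ⟨fun x => Complex.exp (-Complex.I * (inner ℝ x ζ : ℝ)), by
    change ContDiff ℝ ∞ _
    have h : ContDiff ℝ ∞ fun x : E d => ((inner ℝ x ζ : ℝ) : ℂ) :=
      Complex.ofRealCLM.contDiff.comp
        (contDiff_id.inner ℝ (contDiff_const (c := ζ)) : ContDiff ℝ ∞ fun x : E d => inner ℝ x ζ)
    exact (contDiff_const.mul h).cexp⟩

/-- The function `u v̄` for `u, v ∈ ℋ`. -/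
def mulConj {d : ℕ} (u v : Herglotz d) : Smooth d :=
  ⟨fun x => u x * conj (v x),
    show ContDiff ℝ ∞ fun x => u x * conj (v x) from
      u.contDiff.mul (Complex.conjCLE.contDiff.comp v.contDiff)⟩

end Smooth

/-- The space `ℰ'(ℝ^d)` of distributions with compact support: the continuous linear functionals
on `ℰ(ℝ^d)`. -/
abbrev CompactDistribution (d : ℕ) : Type := Smooth d →L[ℂ] ℂ

/-- The Fourier transform `â(ζ) = (2π)^{-d/2} (a, e^{-i x·ζ})` of `a ∈ ℰ'(ℝ^d)`. -/
def fourierE {d : ℕ} (a : CompactDistribution d) (ζ : E d) : ℂ :=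
  (((2 * Real.pi) ^ (-((d : ℝ) / 2)) : ℝ) : ℂ) * a (Smooth.planeWave ζ)

/-! ### Toeplitz operators -/

/-- The sesquilinear form `F_a(u, v) = (a, u v̄)` on `ℋ`. -/
def toeplitzForm {d : ℕ} (a : CompactDistribution d) (u v : Herglotz d) : ℂ :=
  a (Smooth.mulConj u v)

/-- `T` is the Toeplitz operator with symbol `a`: `⟨T u, v⟩ = F_a(u, v)` for all `u, v ∈ ℋ`, where
`⟨·, ·⟩` is linear in the first argument (Mathlib's `inner` is linear in the second one). -/
def IsToeplitz {d : ℕ} (a : CompactDistribution d) (T : Herglotz d →L[ℂ] Herglotz d) : Prop :=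
  ∀ u v : Herglotz d, inner ℂ v (T u) = toeplitzForm a u v

/-! ### Schatten classes -/

section Schatten

variable {H : Type*} [NormedAddCommGroup H] [InnerProductSpace ℂ H] [CompleteSpace H]

/-- The multiplicity of `s > 0` as a singular value of an operator `T` in a Hilbert space: the
dimension of the eigenspace of `T^* T` for the eigenvalue `s^2` (it is `0` if `s` is not a singular
value of `T`, and it is finite if `T` is compact). -/
def singularMult (T : H →L[ℂ] H) (s : ℝ) : ℕ :=
  Module.finrank ℂ (Module.End.eigenspace
    ((T.adjoint ∘L T : H →L[ℂ] H) : H →ₗ[ℂ] H) ((s ^ 2 : ℝ) : ℂ))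

/-- The Schatten class `𝔖_p`, `0 < p < ∞`: the compact operators whose singular values, counted with
multiplicities, are `p`-summable. -/
def IsSchatten (p : ℝ) (T : H →L[ℂ] H) : Prop :=
  IsCompactOperator T ∧
    Summable fun s : {s : ℝ // 0 < s} => (singularMult T s.1 : ℝ) * s.1 ^ p

end Schatten

end Helmholtz

end

noncomputable section

namespace Helmholtz

/-! ### Compactly supported distributions as combinations of functionals of derivatives -/

namespace Smooth

variable {d : ℕ}

/-! For `u = I φ` and `v = I ψ` the product `u v̄` is a superposition over `(η, ξ)` of plane waves
`e^{-i x·(η - ξ)}` with weight `c_d² conj(ψ(η)) φ(ξ)`. Moving `a` under the integral turns the form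
into the one given by the kernel `c_d² (a, e^{-i x·(η - ξ)}) = π (2π)^{-d/2} â(η - ξ)`
(`toeplitzForm_I`). So `T_a` is the unitary conjugate of an integral operator with continuous
kernel, and the form determines it uniquely.

The interchange rests on `CompactDistribution.exists_eq_sum`: continuity of `a` gives a bound by
finitely many derivatives on a ball `B`, and Hahn–Banach writes `a` as a finite sum of functionals
on `C(B)` applied to partial derivatives. In the Banach algebra `C(B)` a plane wave is the
exponential of an element linear in `ζ`. Hence the interchange is a property of Bochner integrals
(`CompactDistribution.apply_integral_wave`), `â` is smooth, and the Taylor polynomials of `exp`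
approximate `â` on `‖ζ‖ ≤ 2` at a geometric rate (`exists_poly_approx_fourierE`).

A polynomial kernel of degree `n` in `η - ξ` sends everything to restrictions of polynomials of
degree at most `n`, so its rank grows polynomially in `n`. Operators approximated geometrically by
ranks of polynomial growth are compact and lie in every Schatten class:
`sum_singularMult_le_finrank` counts the singular values above the error, and
`HasGeometricApprox.isSchatten` sums them over geometric shells. -/

@[simp] lemma coe_add (f g : Smooth d) : ((f + g : Smooth d) : E d → ℂ) = f + g := rfl

@[simp] lemma coe_smul (c : ℂ) (f : Smooth d) : ((c • f : Smooth d) : E d → ℂ) = c • (f : E d → ℂ) :=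
  rfl

lemma contDiff (f : Smooth d) : ContDiff ℝ ∞ (f : E d → ℂ) := f.2

lemma derivC_apply (k : ℕ) (f : Smooth d) (x : E d) : derivC k f x = iteratedFDeriv ℝ k f x := rfl

lemma derivC_smul (k : ℕ) (c : ℂ) (f : Smooth d) (x : E d) :
    derivC k (c • f) x = c • derivC k f x := by
  rw [derivC_apply, derivC_apply, coe_smul]
  exact iteratedFDeriv_const_smul_apply ((f.contDiff.of_le (mod_cast le_top)).contDiffAt)

lemma derivC_add (k : ℕ) (f g : Smooth d) (x : E d) :
    derivC k (f + g) x = derivC k f x + derivC k g x := by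
  simp only [derivC_apply, coe_add]
  exact iteratedFDeriv_add_apply ((f.contDiff.of_le (mod_cast le_top)).contDiffAt)
    ((g.contDiff.of_le (mod_cast le_top)).contDiffAt)

lemma derivC_zero (k : ℕ) : derivC k (0 : Smooth d) = 0 := by
  ext1 x
  simpa using derivC_add k 0 (0 : Smooth d) x

end Smooth

/-- The compact-open topology is that of uniform convergence on compact sets, and each compact set
lies in some closed ball about `0`. -/
lemma ContinuousMap.exists_closedBall_of_mem_nhds_zero {X F : Type*} [NormedAddCommGroup X]
    [ProperSpace X] [NormedAddCommGroup F] {U : Set C(X, F)} (hU : U ∈ nhds (0 : C(X, F))) :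
    ∃ R ε : ℝ, 0 < ε ∧ ∀ f : C(X, F), (∀ x ∈ Metric.closedBall 0 R, ‖f x‖ < ε) → f ∈ U := by
  have hb := ContinuousMap.hasBasis_compactConvergenceUniformity (α := X) (β := F)
  rw [UniformSpace.mem_nhds_iff] at hU
  obtain ⟨V, hV, hVU⟩ := hU
  obtain ⟨⟨K, W⟩, ⟨hK, hW⟩, hKW⟩ := hb.mem_iff.mp hV
  obtain ⟨ε, hε, hεW⟩ := Metric.mem_uniformity_dist.mp hW
  obtain ⟨R, hR⟩ := hK.isBounded.subset_closedBall 0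
  refine ⟨R, ε, hε, fun f hf => hVU (hKW ?_)⟩
  intro x hx
  refine hεW ?_
  simpa [dist_eq_norm] using hf x (hR hx)

/-- A continuous functional on `ℰ` is controlled by finitely many derivatives on a ball. -/
lemma CompactDistribution.exists_bound {d : ℕ} (a : CompactDistribution d) :
    ∃ R ε : ℝ, ∃ N : ℕ, 0 < ε ∧ ∀ g : Smooth d,
      (∀ k < N, ∀ x ∈ Metric.closedBall 0 R, ‖Smooth.derivC k g x‖ < ε) → ‖a g‖ < 1 := by
  have h1 : {g : Smooth d | ‖a g‖ < 1} ∈ nhds (0 : Smooth d) := by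
    have : Filter.Tendsto (fun g => ‖a g‖) (nhds (0 : Smooth d)) (nhds 0) := by
      have := (a.continuous.norm).tendsto 0
      simpa using this
    exact this.eventually_lt_const one_pos
  -- The topology is an infimum over the order of derivative, so only a finite set `I` of orders
  -- matters; the largest radius and order and the smallest tolerance then serve for all of them.
  rw [nhds_iInf, Filter.mem_iInf'] at h1
  obtain ⟨I, hI, V, hV, -, hVeq, -⟩ := h1
  have hex : ∀ k : ℕ, ∃ R ε : ℝ, 0 < ε ∧ ∀ g : Smooth d,
      (∀ x ∈ Metric.closedBall 0 R, ‖Smooth.derivC k g x‖ < ε) → g ∈ V k := by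
    intro k
    have := hV k
    rw [nhds_induced, Filter.mem_comap, Smooth.derivC_zero] at this
    obtain ⟨U, hU, hUV⟩ := this
    obtain ⟨R, ε, hε, h⟩ := ContinuousMap.exists_closedBall_of_mem_nhds_zero hU
    exact ⟨R, ε, hε, fun g hg => hUV (h _ hg)⟩
  choose R ε hε h using hex
  obtain ⟨N, hN⟩ : ∃ N, ∀ k ∈ I, k < N := by
    obtain ⟨M, hM⟩ := hI.bddAbove
    exact ⟨M + 1, fun k hk => Nat.lt_succ_of_le (hM hk)⟩
  obtain ⟨Rm, hRm⟩ : ∃ Rm, ∀ k ∈ I, R k ≤ Rm := by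
    obtain ⟨M, hM⟩ := (hI.image R).bddAbove
    exact ⟨M, fun k hk => hM ⟨k, hk, rfl⟩⟩
  obtain ⟨δ, hδ, hδm⟩ : ∃ δ, 0 < δ ∧ ∀ k ∈ I, δ ≤ ε k := by
    -- Inserting `1` keeps the set nonempty when `I` is empty.
    refine ⟨(insert 1 (hI.toFinset.image ε)).min' (by simp), ?_, fun k hk => ?_⟩
    · rw [Finset.lt_min'_iff]
      intro y hy
      simp only [Finset.mem_insert, Finset.mem_image] at hy
      obtain rfl | ⟨k, -, rfl⟩ := hy
      · exact one_pos
      · exact hε k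
    · exact Finset.min'_le _ _ (by simp; exact Or.inr ⟨k, hk, rfl⟩)
  refine ⟨Rm, δ, N, hδ, fun g hg => ?_⟩
  have : g ∈ {g : Smooth d | ‖a g‖ < 1} := by
    rw [hVeq]
    simp only [Set.mem_iInter]
    intro k hk
    refine h k g fun x hx => ?_
    exact (hg k (hN k hk) x (Metric.closedBall_subset_closedBall (hRm k hk) hx)).trans_le (hδm k hk)
  exact this

/-- The closed ball as a compact space. -/
abbrev Bl (d : ℕ) (R : ℝ) : Type := Metric.closedBall (0 : E d) R

instance (d : ℕ) (R : ℝ) : CompactSpace (Bl d R) :=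
  isCompact_iff_compactSpace.mp (isCompact_closedBall _ _)

/-- The `i`-th unit vector of `ℝ^d`. -/
abbrev unitVec {d : ℕ} (i : Fin d) : E d := EuclideanSpace.single i 1

/-- The multi-indices of length less than `N`. -/
abbrev MIdx (d N : ℕ) : Type := Σ k : Fin N, (Fin k → Fin d)

/-- The partial derivative of a smooth function, restricted to a ball. -/
def partialC {d N : ℕ} (R : ℝ) (s : MIdx d N) : Smooth d →ₗ[ℂ] C(Bl d R, ℂ) where
  toFun g := ⟨fun x => Smooth.derivC s.1 g x fun j => unitVec (s.2 j), by
    exact ((ContinuousMultilinearMap.apply ℝ (fun _ : Fin s.1 => E d) ℂ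
      fun j => unitVec (s.2 j)).continuous.comp (Smooth.derivC s.1 g).continuous).comp
        continuous_subtype_val⟩
  map_add' f g := by
    ext x
    change Smooth.derivC s.1 (f + g) x _ = _
    rw [Smooth.derivC_add]; rfl
  map_smul' c g := by
    ext x
    change Smooth.derivC s.1 (c • g) x _ = _
    rw [Smooth.derivC_smul]; rfl

lemma partialC_apply {d N : ℕ} (R : ℝ) (s : MIdx d N) (g : Smooth d) (x : Bl d R) :
    partialC R s g x = iteratedFDeriv ℝ s.1 g x fun j => unitVec (s.2 j) := rfl

/-- Expanding every argument in the standard basis gives `d ^ k` terms, and each coordinate is at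
most the norm. -/
lemma norm_multilinear_le_of_basis {d k : ℕ} (t : (E d) [×k]→L[ℝ] ℂ) {M : ℝ} (hM : 0 ≤ M)
    (h : ∀ f : Fin k → Fin d, ‖t fun j => unitVec (f j)‖ ≤ M) : ‖t‖ ≤ d ^ k * M := by
  refine t.opNorm_le_bound (by positivity) fun m => ?_
  have hm : m = fun j => ∑ i, m j i • unitVec i := by
    funext j
    ext l
    simp [Pi.single_apply]
  have h1 : t m = ∑ f : Fin k → Fin d, (∏ j, m j (f j)) • t fun j => unitVec (f j) := by
    conv_lhs => rw [hm]
    rw [ContinuousMultilinearMap.map_sum]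
    exact Finset.sum_congr rfl fun f _ => t.map_smul_univ _ _
  rw [h1]
  calc ‖∑ f : Fin k → Fin d, (∏ j, m j (f j)) • t fun j => unitVec (f j)‖
      ≤ ∑ f : Fin k → Fin d, (∏ j, ‖m j‖) * M := by
        refine norm_sum_le_of_le _ fun f _ => ?_
        rw [norm_smul, norm_prod]
        gcongr with j
        · exact PiLp.norm_apply_le (m j) (f j)
        · exact h f
    _ = d ^ k * M * ∏ j, ‖m j‖ := by
        simp
        ring

/-- The vector of all partial derivatives of order less than `N` on a ball. -/
def jet (d N : ℕ) (R : ℝ) : Smooth d →ₗ[ℂ] (MIdx d N → C(Bl d R, ℂ)) :=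
  LinearMap.pi fun s => partialC R s

/-- Homogeneity turns the neighbourhood bound of `exists_bound` into a norm inequality: `g` is
rescaled until its derivatives fall below `ε`. -/
lemma CompactDistribution.exists_norm_le_jet {d : ℕ} (a : CompactDistribution d) :
    ∃ R C : ℝ, ∃ N : ℕ, ∀ g : Smooth d, ‖a g‖ ≤ C * ‖jet d N R g‖ := by
  obtain ⟨R, ε, N, hε, h⟩ := a.exists_bound
  set D : ℝ := (d + 1 : ℝ) ^ N
  have hD : 0 < D := by positivity
  -- The jet of `g` may vanish, so the scaling uses any `t` above its norm, and `t` decreases to the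
  -- norm afterwards. The constant `D` dominates every `d ^ k` with `k < N`.
  have key : ∀ g : Smooth d, ∀ t : ℝ, 0 < t → ‖jet d N R g‖ < t → ‖a g‖ ≤ D / ε * t := by
    intro g t ht hgt
    have hc : 0 < ε / (D * t) := by positivity
    have h1 : ‖a (((ε / (D * t) : ℝ) : ℂ) • g)‖ < 1 := by
      refine h _ fun k hk x hx => ?_
      rw [Smooth.derivC_smul, norm_smul, Complex.norm_real, Real.norm_of_nonneg hc.le]
      have h2 : ‖Smooth.derivC k g x‖ ≤ d ^ k * ‖jet d N R g‖ := by
        refine norm_multilinear_le_of_basis _ (norm_nonneg _) fun f => ?_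
        refine le_trans ?_ (norm_le_pi_norm (jet d N R g) ⟨⟨k, hk⟩, f⟩)
        exact ContinuousMap.norm_coe_le_norm (jet d N R g ⟨⟨k, hk⟩, f⟩) ⟨x, hx⟩
      have h3 : (d : ℝ) ^ k ≤ D := by
        calc (d : ℝ) ^ k ≤ (d + 1 : ℝ) ^ k := by gcongr; linarith
          _ ≤ D := pow_le_pow_right₀ (by linarith [(Nat.cast_nonneg d : (0 : ℝ) ≤ d)]) hk.le
      have h4 : ‖Smooth.derivC k g x‖ < D * t := by
        calc _ ≤ d ^ k * ‖jet d N R g‖ := h2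
          _ ≤ D * ‖jet d N R g‖ := by gcongr
          _ < D * t := by gcongr
      calc ε / (D * t) * ‖Smooth.derivC k g x‖ < ε / (D * t) * (D * t) := by gcongr
        _ = ε := by field_simp
    rw [map_smul, norm_smul, Complex.norm_real, Real.norm_of_nonneg hc.le] at h1
    calc ‖a g‖ = D / ε * t * (ε / (D * t) * ‖a g‖) := by field_simp
      _ ≤ D / ε * t * 1 := by gcongr
      _ = D / ε * t := mul_one _
  refine ⟨R, D / ε, N, fun g => ?_⟩
  have : Filter.Tendsto (fun t : ℝ => D / ε * t) (nhdsWithin ‖jet d N R g‖ (Set.Ioi ‖jet d N R g‖))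
      (nhds (D / ε * ‖jet d N R g‖)) :=
    ((continuous_const.mul continuous_id).tendsto _).mono_left nhdsWithin_le_nhds
  refine ge_of_tendsto this ?_
  filter_upwards [self_mem_nhdsWithin] with t ht
  exact key g t ((norm_nonneg _).trans_lt ht) ht

/-- A distribution with compact support is a finite sum of functionals of partial derivatives. -/
lemma CompactDistribution.exists_eq_sum {d : ℕ} (a : CompactDistribution d) :
    ∃ R : ℝ, ∃ N : ℕ, ∃ ν : MIdx d N → (C(Bl d R, ℂ) →L[ℂ] ℂ),
      ∀ g : Smooth d, a g = ∑ s, ν s (partialC R s g) := by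
  obtain ⟨R, C, N, h⟩ := a.exists_norm_le_jet
  have hker : LinearMap.ker (jet d N R) ≤ LinearMap.ker (a : Smooth d →ₗ[ℂ] ℂ) := by
    intro g hg
    have := h g
    rw [LinearMap.mem_ker.mp hg, norm_zero, mul_zero] at this
    exact norm_le_zero_iff.mp this
  -- The functional `a` factors through the jet, is bounded on the space of jets by the estimate
  -- just obtained, and extends by Hahn–Banach to the whole finite product of copies of `C(B)`.
  let b : LinearMap.range (jet d N R) →ₗ[ℂ] ℂ :=
    (LinearMap.ker (jet d N R)).liftQ a hker ∘ₗ (jet d N R).quotKerEquivRange.symm.toLinearMap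
  have hb : ∀ g : Smooth d, b ⟨jet d N R g, g, rfl⟩ = a g := by
    intro g
    have : (jet d N R).quotKerEquivRange.symm ⟨jet d N R g, g, rfl⟩ =
        Submodule.Quotient.mk g := by
      rw [LinearEquiv.symm_apply_eq]; rfl
    simp only [b, LinearMap.comp_apply, LinearEquiv.coe_coe, this]
    rfl
  let B := b.mkContinuous C (by
    rintro ⟨_, g, rfl⟩
    rw [hb]
    exact h g)
  obtain ⟨A, hA, -⟩ := exists_extension_norm_eq _ B
  refine ⟨R, N, fun s => A ∘L ContinuousLinearMap.single ℂ (fun _ : MIdx d N => C(Bl d R, ℂ)) s,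
    fun g => ?_⟩
  rw [← hb g]
  refine (hA ⟨jet d N R g, g, rfl⟩).symm.trans ?_
  change A (jet d N R g) = _
  conv_lhs => rw [← Finset.univ_sum_single (jet d N R g)]
  rw [map_sum]
  rfl

/-! ### Derivatives of superpositions of plane waves -/

section Waves

variable {d : ℕ} {V : Type*} [NormedAddCommGroup V] [NormedSpace ℝ V]

/-- The pairing under which a superposition of plane waves is a Fourier integral. -/
def wavePairing (p : V →L[ℝ] E d) : V →L[ℝ] E d →L[ℝ] ℝ :=
  ((2 * Real.pi)⁻¹ • innerSL ℝ) ∘L p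

lemma wavePairing_apply (p : V →L[ℝ] E d) (v : V) (x : E d) :
    wavePairing p v x = (2 * Real.pi)⁻¹ * inner ℝ (p v) x := rfl

lemma fourierChar_wavePairing (p : V →L[ℝ] E d) (v : V) (x : E d) :
    (Real.fourierChar (-(wavePairing p v x)) : ℂ) =
      Complex.exp (-Complex.I * (inner ℝ x (p v) : ℝ)) := by
  rw [Real.fourierChar_apply, wavePairing_apply, real_inner_comm]
  congr 1
  push_cast
  have : (Real.pi : ℂ) ≠ 0 := by exact_mod_cast Real.pi_ne_zero
  field_simp

variable [MeasurableSpace V] {μ : Measure V}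

lemma integral_wave_eq (p : V →L[ℝ] E d) (w : V → ℂ) :
    (fun x : E d => ∫ v, w v * Complex.exp (-Complex.I * (inner ℝ x (p v) : ℝ)) ∂μ) =
      VectorFourier.fourierIntegral Real.fourierChar μ (wavePairing p).toLinearMap₁₂ w := by
  funext x
  refine integral_congr_ae (Filter.Eventually.of_forall fun v => ?_)
  change _ = Real.fourierChar (-(wavePairing p v x)) • w v
  rw [Circle.smul_def, fourierChar_wavePairing, smul_eq_mul, mul_comm]

variable [BorelSpace V] [SecondCountableTopology V]

/-- Finite moments of `w` allow differentiation under the integral; each derivative in a direction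
`m j` brings down the factor `-i m_j·p(v)`. -/
lemma iteratedFDeriv_integral_wave (p : V →L[ℝ] E d) {w : V → ℂ}
    (hw : ∀ n : ℕ, Integrable (fun v => ‖v‖ ^ n * ‖w v‖) μ) (hwm : AEStronglyMeasurable w μ)
    (n : ℕ) (x : E d) (m : Fin n → E d) :
    iteratedFDeriv ℝ n
        (fun x : E d => ∫ v, w v * Complex.exp (-Complex.I * (inner ℝ x (p v) : ℝ)) ∂μ) x m =
      ∫ v, w v * ((∏ j, (-Complex.I * (inner ℝ (m j) (p v) : ℝ))) *
        Complex.exp (-Complex.I * (inner ℝ x (p v) : ℝ))) ∂μ := by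
  rw [integral_wave_eq, VectorFourier.iteratedFDeriv_fourierIntegral (N := (⊤ : ℕ∞)) _
    (fun n _ => hw n) hwm (mod_cast le_top)]
  have hi := VectorFourier.integrable_fourierPowSMulRight (wavePairing p) (hw n) hwm
  have hi' : Integrable (fun v => Real.fourierChar (-((wavePairing p).toLinearMap₁₂ v x)) •
      VectorFourier.fourierPowSMulRight (wavePairing p) w v n) μ :=
    (VectorFourier.fourierIntegral_convergent_iff Real.continuous_fourierChar
      (L := (wavePairing p).toLinearMap₁₂) (by exact (wavePairing p).continuous₂) x).mpr hi
  rw [VectorFourier.fourierIntegral, ContinuousMultilinearMap.integral_apply hi']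
  refine integral_congr_ae (Filter.Eventually.of_forall fun v => ?_)
  change (Real.fourierChar (-(wavePairing p v x)) •
      VectorFourier.fourierPowSMulRight (wavePairing p) w v n) m = _
  rw [Circle.smul_def, smul_apply, VectorFourier.fourierPowSMulRight_apply,
    fourierChar_wavePairing]
  simp only [smul_eq_mul, Complex.real_smul, wavePairing_apply]
  have h1 : ∀ j, -Complex.I * ((inner ℝ (m j) (p v) : ℝ) : ℂ) =
      -(2 * Real.pi * Complex.I) * (((2 * Real.pi)⁻¹ * inner ℝ (p v) (m j) : ℝ) : ℂ) := by
    intro j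
    rw [real_inner_comm]
    push_cast
    have : (Real.pi : ℂ) ≠ 0 := by exact_mod_cast Real.pi_ne_zero
    field_simp
  simp only [h1, Finset.prod_mul_distrib, Finset.prod_const, Finset.card_univ, Fintype.card_fin]
  simp only [← Complex.ofReal_prod, Finset.prod_mul_distrib, Finset.prod_const, Finset.card_univ,
    Fintype.card_fin]
  ring

end Waves

/-! ### Plane waves as exponentials in the algebra of continuous functions on a ball -/

section PlaneWave

variable {d : ℕ}

/-- The function `x ↦ -i x·ζ` on a ball, as a linear function of `ζ`. -/
def phase (d : ℕ) (R : ℝ) : E d →L[ℝ] C(Bl d R, ℂ) :=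
  LinearMap.toContinuousLinearMap
    { toFun := fun ζ => ⟨fun x => -Complex.I * (inner ℝ (x : E d) ζ : ℝ), by fun_prop⟩
      map_add' := fun ζ η => by
        ext x
        simp [inner_add_right, mul_add]
      map_smul' := fun c ζ => by
        ext x
        simp [inner_smul_right]; ring }

lemma phase_apply (R : ℝ) (ζ : E d) (x : Bl d R) :
    phase d R ζ x = -Complex.I * (inner ℝ (x : E d) ζ : ℝ) := rfl

/-- Evaluation at `x` is a continuous algebra homomorphism, so it commutes with `exp`. Thus facts
about the exponential of `C(B)` give facts about plane waves uniformly in `x`. -/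
lemma exp_phase_apply (R : ℝ) (ζ : E d) (x : Bl d R) :
    NormedSpace.exp (phase d R ζ) x = Complex.exp (-Complex.I * (inner ℝ (x : E d) ζ : ℝ)) := by
  have := NormedSpace.map_exp (ContinuousMap.evalAlgHom ℂ ℂ x : C(Bl d R, ℂ) →ₐ[ℂ] ℂ)
    (continuous_eval_const x) (phase d R ζ)
  rw [Complex.exp_eq_exp_ℂ, ← phase_apply]
  exact this

lemma contDiff_exp_phase (R : ℝ) :
    ContDiff ℝ ∞ fun ζ : E d => NormedSpace.exp (phase d R ζ) := by
  have h : AnalyticOnNhd ℝ (NormedSpace.exp : C(Bl d R, ℂ) → C(Bl d R, ℂ)) Set.univ :=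
    fun x _ => NormedSpace.exp_analytic x
  exact (contDiffOn_univ.mp (h.contDiffOn uniqueDiffOn_univ)).comp (phase d R).contDiff

/-- The symbol `∏_j (-i ζ_{s_j})` of the partial derivative with multi-index `s`. -/
def partialSymbol {N : ℕ} (s : MIdx d N) (ζ : E d) : ℂ := ∏ j, (-Complex.I * (ζ (s.2 j) : ℝ))

lemma contDiff_partialSymbol {N : ℕ} (s : MIdx d N) : ContDiff ℝ ∞ (partialSymbol s) := by
  unfold partialSymbol
  refine contDiff_prod fun j _ => contDiff_const.mul (Complex.ofRealCLM.contDiff.comp ?_)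
  exact (EuclideanSpace.proj (𝕜 := ℝ) (s.2 j)).contDiff

/-- The partial derivatives of a superposition of plane waves, as an integral in `C(B, ℂ)`. -/
lemma partialC_integral_wave {V : Type*} [NormedAddCommGroup V] [NormedSpace ℝ V]
    [MeasurableSpace V] [BorelSpace V] [SecondCountableTopology V] {μ : Measure V}
    (p : V →L[ℝ] E d) {w : V → ℂ}
    (hw : ∀ n : ℕ, Integrable (fun v => ‖v‖ ^ n * ‖w v‖) μ) (hwm : AEStronglyMeasurable w μ)
    {N : ℕ} (R : ℝ) (s : MIdx d N) (g : Smooth d)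
    (hg : ∀ x, g x = ∫ v, w v * Complex.exp (-Complex.I * (inner ℝ x (p v) : ℝ)) ∂μ)
    (x : Bl d R) :
    partialC R s g x =
      ∫ v, (w v • partialSymbol s (p v) • NormedSpace.exp (phase d R (p v))) x ∂μ := by
  have : (g : E d → ℂ) = fun x => ∫ v, w v * Complex.exp (-Complex.I * (inner ℝ x (p v) : ℝ)) ∂μ :=
    funext hg
  rw [partialC_apply, this, iteratedFDeriv_integral_wave p hw hwm]
  refine integral_congr_ae (Filter.Eventually.of_forall fun v => ?_)
  simp [exp_phase_apply, partialSymbol, EuclideanSpace.inner_single_left]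

lemma partialC_planeWave {N : ℕ} (R : ℝ) (s : MIdx d N) (ζ : E d) :
    partialC R s (Smooth.planeWave ζ) = partialSymbol s ζ • NormedSpace.exp (phase d R ζ) := by
  ext x
  -- A single plane wave is the superposition over a Dirac mass.
  rw [partialC_integral_wave (μ := Measure.dirac ζ) (ContinuousLinearMap.id ℝ (E d)) (w := 1)
    (fun n => integrable_dirac (by simp)) (by fun_prop) R s]
  · simp
  · intro x
    simp [Smooth.planeWave]

end PlaneWave

/-! ### Action on superpositions of plane waves; smoothness of the Fourier transform -/

section FourierTransform

variable {d : ℕ}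

lemma norm_exp_phase_le (R : ℝ) (ζ : E d) : ‖NormedSpace.exp (phase d R ζ)‖ ≤ 1 := by
  refine (ContinuousMap.norm_le _ zero_le_one).mpr fun x => ?_
  rw [exp_phase_apply, Complex.norm_exp]
  simp

lemma norm_partialSymbol_le {N : ℕ} (s : MIdx d N) (ζ : E d) :
    ‖partialSymbol s ζ‖ ≤ ‖ζ‖ ^ (s.1 : ℕ) := by
  rw [partialSymbol, norm_prod]
  refine (Finset.prod_le_prod (fun _ _ => norm_nonneg _) (g := fun _ => ‖ζ‖) fun j _ => ?_).trans
    (by simp)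
  rw [norm_mul, norm_neg, Complex.norm_I, one_mul, Complex.norm_real]
  exact PiLp.norm_apply_le ζ _

/-- A distribution with compact support commutes with superpositions of plane waves. -/
lemma CompactDistribution.apply_integral_wave (a : CompactDistribution d)
    {V : Type*} [NormedAddCommGroup V] [NormedSpace ℝ V]
    [MeasurableSpace V] [BorelSpace V] [SecondCountableTopology V] {μ : Measure V}
    (p : V →L[ℝ] E d) {w : V → ℂ}
    (hw : ∀ n : ℕ, Integrable (fun v => ‖v‖ ^ n * ‖w v‖) μ) (hwm : AEStronglyMeasurable w μ)
    (g : Smooth d)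
    (hg : ∀ x, g x = ∫ v, w v * Complex.exp (-Complex.I * (inner ℝ x (p v) : ℝ)) ∂μ) :
    a g = ∫ v, w v * a (Smooth.planeWave (p v)) ∂μ := by
  obtain ⟨R, N, ν, h⟩ := a.exists_eq_sum
  have hint : ∀ s : MIdx d N, Integrable
      (fun v => w v • partialSymbol s (p v) • NormedSpace.exp (phase d R (p v))) μ := by
    intro s
    refine ((hw s.1).const_mul (‖p‖ ^ (s.1 : ℕ))).mono' ?_ (Filter.Eventually.of_forall fun v => ?_)
    · refine hwm.smul (Continuous.aestronglyMeasurable ?_)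
      exact ((contDiff_partialSymbol s).continuous.comp p.continuous).smul
        ((contDiff_exp_phase R).continuous.comp p.continuous)
    · rw [norm_smul, norm_smul]
      have h1 : ‖partialSymbol s (p v)‖ ≤ ‖p‖ ^ (s.1 : ℕ) * ‖v‖ ^ (s.1 : ℕ) := by
        rw [← mul_pow]
        exact (norm_partialSymbol_le s _).trans (by gcongr; exact p.le_opNorm v)
      calc ‖w v‖ * (‖partialSymbol s (p v)‖ * ‖NormedSpace.exp (phase d R (p v))‖)
          ≤ ‖w v‖ * (‖p‖ ^ (s.1 : ℕ) * ‖v‖ ^ (s.1 : ℕ) * 1) := by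
            gcongr
            exact norm_exp_phase_le R _
        _ = _ := by ring
  -- The pointwise formula becomes a Bochner integral in `C(B)`, under which the continuous
  -- functional `ν s` can be taken.
  have hpart : ∀ s : MIdx d N, partialC R s g =
      ∫ v, w v • partialSymbol s (p v) • NormedSpace.exp (phase d R (p v)) ∂μ := by
    intro s
    ext x
    rw [ContinuousMap.integral_apply (hint s), partialC_integral_wave p hw hwm R s g hg]
  rw [h g]
  simp_rw [h (Smooth.planeWave _), Finset.mul_sum, partialC_planeWave]
  rw [integral_finsetSum]
  · refine Finset.sum_congr rfl fun s _ => ?_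
    rw [hpart s, ← ContinuousLinearMap.integral_comp_comm _ (hint s)]
    refine integral_congr_ae (Filter.Eventually.of_forall fun v => ?_)
    simp only [map_smul, smul_eq_mul]
  · intro s _
    refine ((ν s).integrable_comp (hint s)).congr (Filter.Eventually.of_forall fun v => ?_)
    simp only [map_smul, smul_eq_mul]

/-- After `exists_eq_sum`, `â` is a finite sum of continuous linear functionals applied to smooth
`C(B)`-valued functions of `ζ`. -/
lemma contDiff_fourierE (a : CompactDistribution d) : ContDiff ℝ ∞ (fourierE a) := by
  obtain ⟨R, N, ν, h⟩ := a.exists_eq_sum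
  unfold fourierE
  simp_rw [h, partialC_planeWave]
  refine contDiff_const.mul (ContDiff.sum fun s _ => ?_)
  exact ((ν s).restrictScalars ℝ).contDiff.comp
    ((contDiff_partialSymbol s).smul (contDiff_exp_phase R))

end FourierTransform

/-! ### Polynomials of bounded degree -/

section Polynomials

variable {d : ℕ}

/-- The homogeneous coordinates: the constant `1` and the coordinates of `ℝ^d`. -/
def coord : Option (Fin d) → E d → ℂ
  | none, _ => 1
  | some i, ζ => (ζ i : ℝ)

/-- The monomials of degree at most `n`, indexed by unordered `n`-tuples of homogeneous
coordinates. -/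
def monom {n : ℕ} (s : Sym (Option (Fin d)) n) : E d → ℂ :=
  (s.1.map coord).prod

/-- The complex polynomials of degree at most `n` on `ℝ^d`. -/
def polyLE (d n : ℕ) : Submodule ℂ (E d → ℂ) := Submodule.span ℂ (Set.range (monom (n := n)))

instance (n : ℕ) : FiniteDimensional ℂ (polyLE d n) := by
  unfold polyLE
  exact FiniteDimensional.span_of_finite ℂ (Set.finite_range _)

/-- The multisets of size `n` in `d + 1` letters number `(n + d).choose d`. -/
lemma finrank_polyLE_le (n : ℕ) : Module.finrank ℂ (polyLE d n) ≤ (n + d) ^ d := by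
  refine (finrank_range_le_card _).trans ?_
  rw [Sym.card_sym_eq_multichoose, Nat.multichoose_eq, Fintype.card_option, Fintype.card_fin]
  have : d + 1 + n - 1 = n + d := by omega
  rw [this, ← Nat.choose_symm_add.symm]
  exact Nat.choose_le_pow _ _

lemma monom_cons {n : ℕ} (o : Option (Fin d)) (s : Sym (Option (Fin d)) n) :
    monom (o ::ₛ s) = coord o * monom s := by
  change ((o ::ₘ s.1).map coord).prod = _
  rw [Multiset.map_cons, Multiset.prod_cons]
  rfl

lemma coord_mul_mem {n : ℕ} (o : Option (Fin d)) {f : E d → ℂ} (hf : f ∈ polyLE d n) :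
    coord o * f ∈ polyLE d (n + 1) := by
  induction hf using Submodule.span_induction with
  | mem f hf =>
    obtain ⟨s, rfl⟩ := hf
    rw [← monom_cons]
    exact Submodule.subset_span ⟨_, rfl⟩
  | zero => rw [mul_zero]; exact zero_mem _
  | add f g _ _ hf hg => rw [mul_add]; exact add_mem hf hg
  | smul c f _ hf => rw [mul_smul_comm]; exact Submodule.smul_mem _ c hf

lemma coord_none_mul (f : E d → ℂ) : coord none * f = f := by
  funext ζ
  simp [coord]

/-- Monomials are padded with the homogeneous coordinate `1`. -/
lemma polyLE_mono {m n : ℕ} (h : m ≤ n) : polyLE d m ≤ polyLE d n := by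
  induction n, h using Nat.le_induction with
  | base => exact le_rfl
  | succ n _ ih =>
    intro f hf
    rw [← coord_none_mul f]
    exact coord_mul_mem none (ih hf)

lemma const_mem_polyLE (n : ℕ) (c : ℂ) : (fun _ => c) ∈ polyLE d n := by
  refine polyLE_mono (Nat.zero_le n) ?_
  have : (fun _ => c) = c • monom (d := d) Sym.nil := by
    funext ζ
    simp [monom]
  rw [this]
  exact Submodule.smul_mem _ c (Submodule.subset_span ⟨_, rfl⟩)

lemma continuous_coord (o : Option (Fin d)) : Continuous (coord o) := by
  cases o with
  | none => exact continuous_const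
  | some i =>
    exact Complex.continuous_ofReal.comp (EuclideanSpace.proj (𝕜 := ℝ) i).continuous

/-- Polynomials of degree at most `n + 1` are combinations of products of a homogeneous coordinate
and a polynomial of degree at most `n`. -/
lemma polyLE_induction {P : ℕ → (E d → ℂ) → Prop} (hc : ∀ c : ℂ, P 0 fun _ => c)
    (hadd : ∀ n f g, f ∈ polyLE d n → g ∈ polyLE d n → P n f → P n g → P n (f + g))
    (hsmul : ∀ n f, ∀ c : ℂ, P n f → P n (c • f))
    (hmul : ∀ n f o, f ∈ polyLE d n → P n f → P (n + 1) (coord o * f)) {n : ℕ} {f : E d → ℂ}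
    (hf : f ∈ polyLE d n) : P n f := by
  have key : ∀ n, ∀ s : Sym (Option (Fin d)) n, P n (monom s) := by
    intro n
    induction n with
    | zero =>
      intro s
      rw [Subsingleton.elim s Sym.nil]
      exact hc 1
    | succ n ih =>
      intro s
      obtain ⟨o, s', rfl⟩ := s.exists_eq_cons_of_succ
      rw [monom_cons]
      exact hmul n _ o (Submodule.subset_span ⟨_, rfl⟩) (ih s')
  induction hf using Submodule.span_induction with
  | mem f hf =>
    obtain ⟨s, rfl⟩ := hf
    exact key n s
  | zero =>
    have := hsmul n _ 0 (key n (Sym.replicate n none))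
    rwa [zero_smul] at this
  | add f g hf' hg' hf hg => exact hadd n f g hf' hg' hf hg
  | smul c f _ hf => exact hsmul n f c hf

lemma continuous_of_mem_polyLE {n : ℕ} {f : E d → ℂ} (hf : f ∈ polyLE d n) : Continuous f := by
  refine polyLE_induction (P := fun _ f => Continuous f) (fun c => continuous_const) ?_ ?_ ?_ hf
  · exact fun n f g _ _ hf hg => hf.add hg
  · exact fun n f c hf => hf.const_smul c
  · exact fun n f o _ hf => (continuous_coord o).mul hf

lemma partialSymbol_mul_mem {N n : ℕ} (s : MIdx d N) {f : E d → ℂ} (hf : f ∈ polyLE d n) :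
    (fun ζ => partialSymbol s ζ * f ζ) ∈ polyLE d (n + N) := by
  have key : ∀ T : Finset (Fin s.1), (fun ζ : E d =>
      (∏ j ∈ T, (-Complex.I * (ζ (s.2 j) : ℝ))) * f ζ) ∈ polyLE d (n + T.card) := by
    intro T
    induction T using Finset.induction_on with
    | empty => simpa using hf
    | insert j T hj ih =>
      rw [Finset.card_insert_of_notMem hj, ← add_assoc]
      have := Submodule.smul_mem _ (-Complex.I) (coord_mul_mem (some (s.2 j)) ih)
      convert this using 1
      funext ζ
      simp only [Finset.prod_insert hj, Pi.smul_apply, Pi.mul_apply, smul_eq_mul, coord]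
      ring
  refine polyLE_mono ?_ (key Finset.univ)
  have := s.1.2
  simp only [Finset.card_univ, Fintype.card_fin]
  omega

lemma phase_eq_sum (R : ℝ) (ζ : E d) :
    phase d R ζ = ∑ i, ((ζ i : ℝ) : ℂ) • phase d R (unitVec i) := by
  have : ζ = ∑ i, ζ i • unitVec i := by
    ext l
    simp [Pi.single_apply]
  conv_lhs => rw [this]
  rw [map_sum]
  refine Finset.sum_congr rfl fun i _ => ?_
  rw [map_smul]
  ext x
  simp

/-- One factor of the power splits as `∑ ζ_i • phase (e_i)`. The coordinate `ζ_i` raises the degree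
by one, while multiplication by `phase (e_i)` is absorbed into `l`; hence the induction runs over
all `l`. -/
lemma functional_phase_pow_mem (R : ℝ) (m : ℕ) (l : C(Bl d R, ℂ) →ₗ[ℂ] ℂ) :
    (fun ζ => l (phase d R ζ ^ m)) ∈ polyLE d m := by
  induction m generalizing l with
  | zero =>
    simp only [pow_zero]
    exact const_mem_polyLE 0 _
  | succ m ih =>
    have : (fun ζ => l (phase d R ζ ^ (m + 1))) = ∑ i : Fin d, coord (some i) *
        fun ζ => (l ∘ₗ LinearMap.mulLeft ℂ (phase d R (unitVec i))) (phase d R ζ ^ m) := by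
      funext ζ
      rw [pow_succ']
      nth_rewrite 1 [phase_eq_sum R ζ]
      rw [Finset.sum_mul, map_sum, Finset.sum_apply]
      refine Finset.sum_congr rfl fun i _ => ?_
      rw [smul_mul_assoc, map_smul]
      rfl
    rw [this]
    exact sum_mem fun i _ => coord_mul_mem _ (ih _)

/-- The Fourier transform of a distribution with compact support is approximated on a ball by
polynomials at a geometric rate. -/
lemma exists_poly_approx_fourierE (a : CompactDistribution d) (r : ℝ) :
    ∃ C q : ℝ, ∃ N : ℕ, 0 ≤ C ∧ 0 < q ∧ q < 1 ∧ ∀ n : ℕ, ∃ f ∈ polyLE d (n + N),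
      ∀ ζ : E d, ‖ζ‖ ≤ r → ‖fourierE a ζ - f ζ‖ ≤ C * q ^ n := by
  obtain ⟨R, N, ν, h⟩ := a.exists_eq_sum
  set c : ℂ := (((2 * Real.pi) ^ (-((d : ℝ) / 2)) : ℝ) : ℂ) with hc
  have hpow := NormedSpace.exp_hasFPowerSeriesOnBall (𝕂 := ℂ) (𝔸 := C(Bl d R, ℂ))
  -- The exponential series has infinite radius, so any ball will do; this open one contains `phase
  -- d R ζ` for all `‖ζ‖ ≤ r`.
  obtain ⟨q, ⟨hq0, hq1⟩, C₀, hC₀, happ⟩ := hpow.uniform_geometric_approx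
    (r' := Real.toNNReal (‖phase d R‖ * |r| + 1)) ENNReal.coe_lt_top
  let A : ℝ := ‖c‖ * ∑ s : MIdx d N, |r| ^ (s.1 : ℕ) * (‖ν s‖ * C₀)
  refine ⟨A, q, N, by positivity, hq0, hq1, fun n => ?_⟩
  -- The exponential is truncated before order `n`; the symbols add degree less than `N`.
  let f : E d → ℂ := fun ζ => c * ∑ s : MIdx d N, partialSymbol s ζ *
    ∑ m ∈ Finset.range n, ((m.factorial : ℂ)⁻¹) * ν s (phase d R ζ ^ m)
  refine ⟨f, ?_, fun ζ hζ => ?_⟩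
  · have hf : f = c • ∑ s : MIdx d N, fun ζ => partialSymbol s ζ *
        (∑ m ∈ Finset.range n, ((m.factorial : ℂ)⁻¹) • fun ζ => ν s (phase d R ζ ^ m)) ζ := by
      funext ζ
      simp [f, Finset.sum_apply]
    rw [hf]
    refine Submodule.smul_mem _ c (sum_mem fun s _ => partialSymbol_mul_mem s (sum_mem fun m hm => ?_))
    refine Submodule.smul_mem _ _ (polyLE_mono (Finset.mem_range.mp hm).le ?_)
    exact functional_phase_pow_mem R m (ν s : C(Bl d R, ℂ) →ₗ[ℂ] ℂ)
  · have hζ' : ‖ζ‖ ≤ |r| := hζ.trans (le_abs_self r)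
    have hball : phase d R ζ ∈
        Metric.ball (0 : C(Bl d R, ℂ)) (Real.toNNReal (‖phase d R‖ * |r| + 1)) := by
      rw [mem_ball_zero_iff, Real.coe_toNNReal _ (by positivity)]
      calc ‖phase d R ζ‖ ≤ ‖phase d R‖ * ‖ζ‖ := (phase d R).le_opNorm ζ
        _ ≤ ‖phase d R‖ * |r| := by gcongr
        _ < _ := lt_add_one _
    have herr := happ _ hball n
    rw [zero_add] at herr
    set D := NormedSpace.exp (phase d R ζ) -
      (NormedSpace.expSeries ℂ C(Bl d R, ℂ)).partialSum n (phase d R ζ) with hD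
    have hdiff : fourierE a ζ - f ζ = c * ∑ s : MIdx d N, partialSymbol s ζ * ν s D := by
      simp only [fourierE, f, h, partialC_planeWave, ← hc]
      rw [← mul_sub, ← Finset.sum_sub_distrib]
      congr 1
      refine Finset.sum_congr rfl fun s _ => ?_
      rw [hD, map_smul, smul_eq_mul, map_sub, mul_sub]
      congr 2
      rw [FormalMultilinearSeries.partialSum, map_sum]
      refine Finset.sum_congr rfl fun m _ => ?_
      rw [NormedSpace.expSeries_apply_eq, map_smul, smul_eq_mul]
    rw [hdiff, norm_mul]
    simp only [A]
    rw [mul_assoc, Finset.sum_mul]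
    gcongr
    refine norm_sum_le_of_le _ fun s _ => ?_
    rw [norm_mul]
    calc ‖partialSymbol s ζ‖ * ‖ν s D‖ ≤ |r| ^ (s.1 : ℕ) * (‖ν s‖ * (C₀ * q ^ n)) := by
          gcongr
          · exact (norm_partialSymbol_le s ζ).trans (by gcongr)
          · exact ((ν s).le_opNorm D).trans (by gcongr)
      _ = _ := by ring

end Polynomials

/-! ### Singular values and approximation by operators of finite rank -/

section Approximation

variable {H : Type*} [NormedAddCommGroup H] [InnerProductSpace ℂ H] [CompleteSpace H]

/-- The number of singular values greater than `δ` is at most the rank of any operator at distance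
at most `δ`. -/
lemma sum_singularMult_le_finrank (T F : H →L[ℂ] H) {δ : ℝ} (hF : ‖T - F‖ ≤ δ)
    [FiniteDimensional ℂ (LinearMap.range (F : H →ₗ[ℂ] H))] (u : Finset {s : ℝ // 0 < s})
    (hu : ∀ s ∈ u, δ < s.1) :
    ∑ s ∈ u, singularMult T s.1 ≤ Module.finrank ℂ (LinearMap.range (F : H →ₗ[ℂ] H)) := by
  have hδ : 0 ≤ δ := (norm_nonneg _).trans hF
  set A : H →ₗ[ℂ] H := ((T.adjoint ∘L T : H →L[ℂ] H) : H →ₗ[ℂ] H) with hA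
  have hsymm : A.IsSymmetric := fun x y => by
    change inner ℂ (T.adjoint (T x)) y = inner ℂ x (T.adjoint (T y))
    rw [ContinuousLinearMap.adjoint_inner_left, ContinuousLinearMap.adjoint_inner_right]
  let ev : u → ℂ := fun s => ((s.1.1 ^ 2 : ℝ) : ℂ)
  have hev : Function.Injective ev := by
    intro s t hst
    have h1 : s.1.1 ^ 2 = t.1.1 ^ 2 := Complex.ofReal_injective hst
    exact Subtype.ext (Subtype.ext ((sq_eq_sq₀ s.1.2.le t.1.2.le).mp h1))
  have horth := hsymm.orthogonalFamily_eigenspaces.comp hev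
  let Φ : (∀ s : u, Module.End.eigenspace A (ev s)) →ₗ[ℂ] H :=
    ∑ s : u, (Module.End.eigenspace A (ev s)).subtype ∘ₗ LinearMap.proj s
  have hΦ : ∀ v, Φ v = ∑ s : u, (v s : H) := fun v => by simp [Φ]
  -- If `F` kills a sum `v` of eigenvectors `v_s`, then `‖T v‖ ≤ δ ‖v‖`; but orthogonality gives `‖T
  -- v‖² = ∑ s² ‖v_s‖²` with every `s > δ`, so `v = 0`.
  have hinj : Function.Injective ((F : H →ₗ[ℂ] H).rangeRestrict ∘ₗ Φ) := by
    rw [← LinearMap.ker_eq_bot, LinearMap.ker_eq_bot']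
    intro v hv
    have hFv : F (Φ v) = 0 := congrArg Subtype.val hv
    have h1 : ‖T (Φ v)‖ ≤ δ * ‖Φ v‖ := by
      have : T (Φ v) = (T - F) (Φ v) := by simp [hFv]
      rw [this]
      exact (T - F).le_of_opNorm_le hF _
    have h2 : ‖Φ v‖ ^ 2 = ∑ s : u, ‖v s‖ ^ 2 := by
      rw [hΦ]
      exact horth.norm_sum v Finset.univ
    have h3 : ‖T (Φ v)‖ ^ 2 = ∑ s : u, s.1.1 ^ 2 * ‖v s‖ ^ 2 := by
      have h4 : A (Φ v) = ∑ s : u, ((ev s • v s : Module.End.eigenspace A (ev s)) : H) := by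
        rw [hΦ, map_sum]
        exact Finset.sum_congr rfl fun s _ => Module.End.mem_eigenspace_iff.mp (v s).2
      have h5 : inner ℂ (Φ v) (A (Φ v)) = ∑ s : u, inner ℂ (v s) (ev s • v s) := by
        rw [h4, hΦ]
        exact horth.inner_sum v (fun s => ev s • v s) Finset.univ
      have h6 : inner ℂ (Φ v) (A (Φ v)) = ((‖T (Φ v)‖ ^ 2 : ℝ) : ℂ) := by
        change inner ℂ (Φ v) (T.adjoint (T (Φ v))) = _
        rw [ContinuousLinearMap.adjoint_inner_right, inner_self_eq_norm_sq_to_K]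
        norm_cast
      rw [h6] at h5
      have h7 : ∀ s : u, inner ℂ (v s) (ev s • v s) = ((s.1.1 ^ 2 * ‖v s‖ ^ 2 : ℝ) : ℂ) := by
        intro s
        rw [inner_smul_right, inner_self_eq_norm_sq_to_K]
        simp [ev]
      simp_rw [h7] at h5
      exact_mod_cast h5
    have h8 : ∑ s : u, (s.1.1 ^ 2 - δ ^ 2) * ‖v s‖ ^ 2 ≤ 0 := by
      have h9 : ‖T (Φ v)‖ ^ 2 ≤ δ ^ 2 * ‖Φ v‖ ^ 2 := by
        rw [← mul_pow]
        gcongr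
      rw [h3, h2, Finset.mul_sum] at h9
      simp only [sub_mul, Finset.sum_sub_distrib]
      linarith
    have hpos : ∀ s : u, 0 < s.1.1 ^ 2 - δ ^ 2 := fun s => by
      have := hu s.1 s.2
      have := pow_lt_pow_left₀ this hδ two_ne_zero
      linarith
    have h10 := (Finset.sum_eq_zero_iff_of_nonneg fun s _ =>
      mul_nonneg (hpos s).le (sq_nonneg ‖v s‖)).mp
        (le_antisymm h8 (Finset.sum_nonneg fun s _ => mul_nonneg (hpos s).le (sq_nonneg ‖v s‖)))
    funext s
    have h11 := h10 s (Finset.mem_univ s)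
    have := (mul_eq_zero.mp h11).resolve_left (hpos s).ne'
    simpa using this
  -- Injectivity also makes the eigenspaces finite-dimensional, so `finrank` of their product is the
  -- sum of the multiplicities.
  have hfin : Module.Finite ℂ (∀ s : u, Module.End.eigenspace A (ev s)) :=
    Module.Finite.of_injective _ hinj
  have hfin' : ∀ s : u, Module.Finite ℂ (Module.End.eigenspace A (ev s)) := fun s =>
    Module.Finite.of_surjective
      (LinearMap.proj s : (∀ s : u, Module.End.eigenspace A (ev s)) →ₗ[ℂ] _)
      (Function.surjective_eval s)
  have := LinearMap.finrank_le_finrank_of_injective hinj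
  rw [Module.finrank_pi_fintype] at this
  rw [← Finset.sum_coe_sort]
  exact this

omit [CompleteSpace H] in
lemma isCompactOperator_of_finiteDimensional_range (F : H →L[ℂ] H)
    [FiniteDimensional ℂ (LinearMap.range (F : H →ₗ[ℂ] H))] : IsCompactOperator F := by
  have : ProperSpace (LinearMap.range (F : H →ₗ[ℂ] H)) := FiniteDimensional.proper ℂ _
  let G : H →L[ℂ] LinearMap.range (F : H →ₗ[ℂ] H) := F.codRestrict _ fun x => ⟨x, rfl⟩
  refine ⟨(↑) '' Metric.closedBall (0 : LinearMap.range (F : H →ₗ[ℂ] H)) 1,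
    (isCompact_closedBall _ _).image continuous_subtype_val, ?_⟩
  have h0 : G ⁻¹' Metric.closedBall 0 1 ∈ nhds (0 : H) := by
    refine G.continuous.continuousAt.preimage_mem_nhds ?_
    rw [map_zero]
    exact Metric.closedBall_mem_nhds _ one_pos
  filter_upwards [h0] with x hx
  exact ⟨G x, hx, rfl⟩

/-- An operator that is approximated at a geometric rate by operators whose ranks grow at most
polynomially. -/
def HasGeometricApprox (T : H →L[ℂ] H) : Prop :=
  ∃ C q : ℝ, ∃ c e : ℕ, 0 < q ∧ q < 1 ∧ ∀ n : ℕ, ∃ F : H →L[ℂ] H,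
    FiniteDimensional ℂ (LinearMap.range (F : H →ₗ[ℂ] H)) ∧
    Module.finrank ℂ (LinearMap.range (F : H →ₗ[ℂ] H)) ≤ (n + c) ^ e ∧ ‖T - F‖ ≤ C * q ^ n

lemma HasGeometricApprox.isCompactOperator {T : H →L[ℂ] H} (hT : HasGeometricApprox T) :
    IsCompactOperator T := by
  obtain ⟨C, q, c, e, hq0, hq1, h⟩ := hT
  choose F hF _ hTF using h
  refine isCompactOperator_of_tendsto (F := F) (l := Filter.atTop) ?_
    (Filter.Eventually.of_forall fun n => ?_)
  · rw [tendsto_iff_norm_sub_tendsto_zero]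
    have hlim : Filter.Tendsto (fun n : ℕ => C * q ^ n) Filter.atTop (nhds 0) := by
      simpa using (tendsto_pow_atTop_nhds_zero_of_lt_one hq0.le hq1).const_mul C
    refine squeeze_zero (fun _ => norm_nonneg _) (fun n => ?_) hlim
    rw [norm_sub_rev]
    exact hTF n
  · have := hF n
    exact isCompactOperator_of_finiteDimensional_range (F n)

/-- The singular values are grouped into shells `C q^(n+1) < s ≤ C q^n`. The approximant of index `n
+ 1` allows at most `(n + 1 + c)^e` of them, so the shell contributes at most a polynomial in `n`
times a multiple of `(q^p)^n`, which is summable. -/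
lemma HasGeometricApprox.isSchatten {T : H →L[ℂ] H} (hT : HasGeometricApprox T) {p : ℝ}
    (hp : 0 < p) : IsSchatten p T := by
  refine ⟨hT.isCompactOperator, ?_⟩
  obtain ⟨C₀, q, c, e, hq0, hq1, h⟩ := hT
  choose F hF hrank hTF₀ using h
  -- The enlarged constant is positive and exceeds `‖T‖`; comparison with the zero operator, of rank
  -- `0`, then excludes singular values above it.
  set C : ℝ := max C₀ ‖T‖ + 1
  have hC : 0 < C := by positivity
  have hTC : ‖T‖ < C := (le_max_right _ _).trans_lt (lt_add_one _)
  have hTF : ∀ n, ‖T - F n‖ ≤ C * q ^ n := fun n => (hTF₀ n).trans (by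
    gcongr
    exact (le_max_left _ _).trans (lt_add_one _).le)
  have hlarge : ∀ s : {s : ℝ // 0 < s}, C < s.1 → singularMult T s.1 = 0 := by
    intro s hs
    have : FiniteDimensional ℂ (LinearMap.range ((0 : H →L[ℂ] H) : H →ₗ[ℂ] H)) := by
      rw [ContinuousLinearMap.toLinearMap_zero, LinearMap.range_zero]
      infer_instance
    have := sum_singularMult_le_finrank T 0 (δ := C) (by simpa using hTC.le) {s} (by simpa using hs)
    rw [ContinuousLinearMap.toLinearMap_zero, LinearMap.range_zero] at this
    simpa using this
  -- The index is `0` by default when `s > C`; such `s` have multiplicity zero and are filtered out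
  -- below.
  have hshell : ∀ s : {s : ℝ // 0 < s}, ∃ n : ℕ, s.1 ≤ C → C * q ^ (n + 1) < s.1 ∧ s.1 ≤ C * q ^ n := by
    intro s
    by_cases hs : s.1 ≤ C
    · obtain ⟨n, h1, h2⟩ := exists_nat_pow_near_of_lt_one (div_pos s.2 hC)
        ((div_le_one hC).mpr hs) hq0 hq1
      refine ⟨n, fun _ => ⟨?_, ?_⟩⟩
      · rwa [lt_div_iff₀' hC] at h1
      · rwa [div_le_iff₀' hC] at h2
    · exact ⟨0, fun h => absurd h hs⟩
  choose N hN using hshell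
  set ρ : ℝ := q ^ p
  have hρ0 : 0 < ρ := Real.rpow_pos_of_pos hq0 p
  have hρ1 : ρ < 1 := Real.rpow_lt_one hq0.le hq1 hp
  let b : ℕ → ℝ := fun n => ((n + 1 + c : ℕ) : ℝ) ^ e * (C * q ^ n) ^ p
  have hb0 : ∀ n, 0 ≤ b n := fun n => by positivity
  have hb : Summable b := by
    have h1 : Summable fun n : ℕ => (n : ℝ) ^ e * ρ ^ n :=
      summable_pow_mul_geometric_of_norm_lt_one e (by rwa [Real.norm_of_nonneg hρ0.le])
    have h2 := ((summable_nat_add_iff (1 + c)).mpr h1).mul_left (C ^ p * (ρ ^ (1 + c))⁻¹)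
    refine h2.congr fun n => ?_
    have h3 : (C * q ^ n) ^ p = C ^ p * ρ ^ n := by
      rw [Real.mul_rpow hC.le (by positivity), ← Real.rpow_natCast, ← Real.rpow_natCast,
        ← Real.rpow_mul hq0.le, ← Real.rpow_mul hq0.le, mul_comm p]
    simp only [b, h3, ← add_assoc]
    rw [pow_add ρ, pow_add ρ, pow_add ρ]
    field_simp
  refine summable_of_sum_le (c := ∑' n, b n)
    (fun s => mul_nonneg (Nat.cast_nonneg _) (Real.rpow_nonneg s.2.le _)) fun u => ?_
  have h1 : ∑ s ∈ u, (singularMult T s.1 : ℝ) * s.1 ^ p =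
      ∑ s ∈ u with s.1 ≤ C, (singularMult T s.1 : ℝ) * s.1 ^ p := by
    refine (Finset.sum_filter_of_ne fun s _ hs => ?_).symm
    by_contra! hcon
    exact hs (by rw [hlarge s hcon]; simp)
  rw [h1, ← Finset.sum_fiberwise_of_maps_to (g := N) (t := (u.filter fun s => s.1 ≤ C).image N)
    fun s hs => Finset.mem_image_of_mem N hs]
  refine (Finset.sum_le_sum fun n _ => ?_).trans (hb.sum_le_tsum _ fun n _ => hb0 n)
  set w := (u.filter fun s => s.1 ≤ C).filter fun s => N s = n
  have hw : ∀ s ∈ w, C * q ^ (n + 1) < s.1 ∧ s.1 ≤ C * q ^ n := by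
    intro s hs
    simp only [w, Finset.mem_filter] at hs
    obtain ⟨⟨-, hsC⟩, rfl⟩ := hs
    exact hN s hsC
  have := hF (n + 1)
  have hcount := (sum_singularMult_le_finrank T (F (n + 1)) (hTF (n + 1)) w
    fun s hs => (hw s hs).1).trans (hrank (n + 1))
  calc ∑ s ∈ w, (singularMult T s.1 : ℝ) * s.1 ^ p
      ≤ ∑ s ∈ w, (singularMult T s.1 : ℝ) * (C * q ^ n) ^ p := by
        refine Finset.sum_le_sum fun s hs => ?_
        have := s.2
        gcongr
        exact (hw s hs).2
    _ = ((∑ s ∈ w, singularMult T s.1 : ℕ) : ℝ) * (C * q ^ n) ^ p := by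
        rw [← Finset.sum_mul]
        push_cast
        rfl
    _ ≤ b n := by
        simp only [b]
        gcongr
        exact_mod_cast hcount

end Approximation

/-! ### Convolution operators on the sphere -/

section Convolution

variable {d : ℕ}

lemma exists_integral_norm_le (d : ℕ) :
    ∃ A : ℝ, 0 ≤ A ∧ ∀ φ : L2S d, ∫ ξ, ‖φ ξ‖ ∂(surf d) ≤ A * ‖φ‖ := by
  refine ⟨((surf d) Set.univ ^ (1 / (1 : ENNReal).toReal - 1 / (2 : ENNReal).toReal)).toReal,
    ENNReal.toReal_nonneg, fun φ => ?_⟩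
  have h := eLpNorm_le_eLpNorm_mul_rpow_measure_univ (p := 1) (q := 2) one_le_two
    (Lp.aestronglyMeasurable φ)
  have hfin : (surf d) Set.univ ^ (1 / (1 : ENNReal).toReal - 1 / (2 : ENNReal).toReal) ≠ ⊤ :=
    ENNReal.rpow_ne_top_of_nonneg (by norm_num) (measure_ne_top _ _)
  have h2 := ENNReal.toReal_mono (ENNReal.mul_ne_top (Lp.eLpNorm_ne_top φ) hfin) h
  rw [ENNReal.toReal_mul, eLpNorm_one_eq_lintegral_enorm,
    ← integral_norm_eq_lintegral_enorm (Lp.aestronglyMeasurable φ)] at h2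
  rw [Lp.norm_def, mul_comm]
  exact h2

lemma norm_sub_le_two (η ξ : S d) : ‖(η : E d) - ξ‖ ≤ 2 := by
  have h1 := norm_sub_le (η : E d) ξ
  have h2 : ‖(η : E d)‖ = 1 := norm_eq_of_mem_sphere η
  have h3 : ‖(ξ : E d)‖ = 1 := norm_eq_of_mem_sphere ξ
  linarith

lemma exists_bound_of_continuous (k : C(E d, ℂ)) :
    ∃ M : ℝ, 0 ≤ M ∧ ∀ ζ : E d, ‖ζ‖ ≤ 2 → ‖k ζ‖ ≤ M := by
  obtain ⟨M, hM⟩ := (isCompact_closedBall (0 : E d) 2).exists_bound_of_continuousOn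
    k.continuous.continuousOn
  exact ⟨M, (norm_nonneg _).trans (hM 0 (by simp)), fun ζ hζ => hM ζ (by simpa using hζ)⟩

lemma integrable_conv {k : E d → ℂ} (hk : Continuous k) {φ : S d → ℂ}
    (hφ : Integrable φ (surf d)) (x : E d) :
    Integrable (fun ξ : S d => k (x - ξ) * φ ξ) (surf d) := by
  let g : C(S d, ℂ) := ⟨fun ξ => k (x - ξ), by fun_prop⟩
  exact hφ.bdd_mul g.continuous.aestronglyMeasurable
    (Filter.Eventually.of_forall fun ξ => g.norm_coe_le_norm ξ)

/-- The function `η ↦ ∫ k(η - ξ) φ(ξ) dS(ξ)` on the sphere. -/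
def convC (k : C(E d, ℂ)) (φ : L2S d) : C(S d, ℂ) :=
  ⟨fun η => ∫ ξ, k ((η : E d) - ξ) * φ ξ ∂(surf d), by
    obtain ⟨M, -, hM⟩ := exists_bound_of_continuous k
    refine continuous_of_dominated (bound := fun ξ => M * ‖φ ξ‖)
      (fun η => (integrable_conv k.continuous (integrable_coe φ) η).aestronglyMeasurable)
      (fun η => Filter.Eventually.of_forall fun ξ => ?_) ((integrable_coe φ).norm.const_mul M)
      (Filter.Eventually.of_forall fun ξ => by fun_prop)
    rw [norm_mul]
    gcongr
    exact hM _ (norm_sub_le_two η ξ)⟩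

lemma norm_convC_le {k : C(E d, ℂ)} {M : ℝ} (hM0 : 0 ≤ M) (hM : ∀ ζ : E d, ‖ζ‖ ≤ 2 → ‖k ζ‖ ≤ M)
    (φ : L2S d) : ‖convC k φ‖ ≤ M * ∫ ξ, ‖φ ξ‖ ∂(surf d) := by
  refine (ContinuousMap.norm_le _
    (mul_nonneg hM0 (integral_nonneg fun _ => norm_nonneg _))).mpr fun η => ?_
  rw [← integral_const_mul]
  refine norm_integral_le_of_norm_le ((integrable_coe φ).norm.const_mul M)
    (Filter.Eventually.of_forall fun ξ => ?_)
  rw [norm_mul]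
  gcongr
  exact hM _ (norm_sub_le_two η ξ)

/-- The map `φ ↦ ∫ k(· - ξ) φ(ξ) dS(ξ)` from `L₂(S)` to `C(S)`. -/
def convL (k : C(E d, ℂ)) : L2S d →L[ℂ] C(S d, ℂ) :=
  LinearMap.mkContinuousOfExistsBound
    { toFun := convC k
      map_add' := fun φ ψ => by
        ext η
        change ∫ ξ, k ((η : E d) - ξ) * (φ + ψ : L2S d) ξ ∂(surf d) =
          (∫ ξ, k ((η : E d) - ξ) * φ ξ ∂(surf d)) + ∫ ξ, k ((η : E d) - ξ) * ψ ξ ∂(surf d)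
        rw [← integral_add (integrable_conv k.continuous (integrable_coe φ) _)
          (integrable_conv k.continuous (integrable_coe ψ) _)]
        refine integral_congr_ae ?_
        filter_upwards [Lp.coeFn_add φ ψ] with ξ h
        rw [h, Pi.add_apply, mul_add]
      map_smul' := fun c φ => by
        ext η
        change ∫ ξ, k ((η : E d) - ξ) * (c • φ : L2S d) ξ ∂(surf d) =
          c * ∫ ξ, k ((η : E d) - ξ) * φ ξ ∂(surf d)
        rw [← integral_const_mul]
        refine integral_congr_ae ?_
        filter_upwards [Lp.coeFn_smul c φ] with ξ h
        rw [h, Pi.smul_apply, smul_eq_mul, mul_left_comm] }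
    (by
      obtain ⟨M, hM0, hM⟩ := exists_bound_of_continuous k
      obtain ⟨A, -, hA⟩ := exists_integral_norm_le d
      refine ⟨M * A, fun φ => (norm_convC_le hM0 hM φ).trans ?_⟩
      rw [mul_assoc]
      exact mul_le_mul_of_nonneg_left (hA φ) hM0)

/-- The integral operator on `L₂(S)` with kernel `k(η - ξ)`. -/
def sphereConv (k : C(E d, ℂ)) : L2S d →L[ℂ] L2S d :=
  ContinuousMap.toLp 2 (surf d) ℂ ∘L convL k

lemma sphereConv_ae (k : C(E d, ℂ)) (φ : L2S d) :
    ∀ᵐ η ∂(surf d), sphereConv k φ η = ∫ ξ, k ((η : E d) - ξ) * φ ξ ∂(surf d) :=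
  ContinuousMap.coeFn_toLp (p := 2) (𝕜 := ℂ) (surf d) (convL k φ)

lemma convL_sub (k l : C(E d, ℂ)) : convL (k - l) = convL k - convL l := by
  ext φ η
  change ∫ ξ, (k ((η : E d) - ξ) - l ((η : E d) - ξ)) * φ ξ ∂(surf d) =
    (∫ ξ, k ((η : E d) - ξ) * φ ξ ∂(surf d)) - ∫ ξ, l ((η : E d) - ξ) * φ ξ ∂(surf d)
  rw [← integral_sub (integrable_conv k.continuous (integrable_coe φ) _)
    (integrable_conv l.continuous (integrable_coe φ) _)]
  simp_rw [sub_mul]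

lemma sphereConv_sub (k l : C(E d, ℂ)) : sphereConv (k - l) = sphereConv k - sphereConv l := by
  rw [sphereConv, convL_sub, ContinuousLinearMap.comp_sub]
  rfl

/-- Differences of unit vectors have norm at most `2`, so uniform approximation of the kernel on
that ball is approximation of the operator in norm. -/
lemma exists_norm_sphereConv_le (d : ℕ) : ∃ B : ℝ, 0 ≤ B ∧ ∀ (k : C(E d, ℂ)) (M : ℝ), 0 ≤ M →
    (∀ ζ : E d, ‖ζ‖ ≤ 2 → ‖k ζ‖ ≤ M) → ‖sphereConv k‖ ≤ B * M := by
  obtain ⟨A, hA0, hA⟩ := exists_integral_norm_le d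
  refine ⟨‖(ContinuousMap.toLp 2 (surf d) ℂ : C(S d, ℂ) →L[ℂ] L2S d)‖ * A, by positivity,
    fun k M hM0 hM => ?_⟩
  refine (ContinuousLinearMap.opNorm_comp_le _ _).trans ?_
  rw [mul_assoc]
  gcongr
  refine ContinuousLinearMap.opNorm_le_bound _ (by positivity) fun φ => ?_
  refine (norm_convC_le hM0 hM φ).trans ?_
  rw [mul_comm A, mul_assoc]
  exact mul_le_mul_of_nonneg_left (hA φ) hM0

/-- Convolution with a polynomial is a polynomial. -/
lemma conv_mem_polyLE {n : ℕ} {f : E d → ℂ} (hf : f ∈ polyLE d n) {φ : S d → ℂ}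
    (hφ : Integrable φ (surf d)) :
    (fun x : E d => ∫ ξ : S d, f (x - (ξ : E d)) * φ ξ ∂(surf d)) ∈ polyLE d n := by
  refine polyLE_induction (P := fun n f => ∀ φ : S d → ℂ, Integrable φ (surf d) →
    (fun x : E d => ∫ ξ : S d, f (x - (ξ : E d)) * φ ξ ∂(surf d)) ∈ polyLE d n) ?_ ?_ ?_ ?_ hf φ hφ
  · exact fun c φ _ => const_mem_polyLE 0 _
  · intro n f g hf hg ihf ihg φ hφ
    convert add_mem (ihf φ hφ) (ihg φ hφ) using 1
    funext x
    simp only [Pi.add_apply, add_mul]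
    exact integral_add (integrable_conv (continuous_of_mem_polyLE hf) hφ x)
      (integrable_conv (continuous_of_mem_polyLE hg) hφ x)
  · intro n f c ih φ hφ
    convert Submodule.smul_mem _ c (ih φ hφ) using 1
    funext x
    simp only [Pi.smul_apply, smul_eq_mul, mul_assoc]
    exact integral_const_mul _ _
  · intro n f o hf ih φ hφ
    cases o with
    | none =>
      rw [coord_none_mul]
      exact polyLE_mono (Nat.le_succ n) (ih φ hφ)
    | some i =>
      -- The factor `x_i - ξ_i` is split: `x_i` leaves the integral and raises the degree, while
      -- `ξ_i` is absorbed into the density. This is why the induction runs over all integrable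
      -- densities.
      have hφ' : Integrable (fun ξ : S d => coord (some i) (ξ : E d) * φ ξ) (surf d) := by
        let g : C(S d, ℂ) := ⟨fun ξ => coord (some i) (ξ : E d),
          (continuous_coord _).comp continuous_subtype_val⟩
        exact hφ.bdd_mul g.continuous.aestronglyMeasurable
          (Filter.Eventually.of_forall fun ξ => g.norm_coe_le_norm ξ)
      have h1 := coord_mul_mem (some i) (ih φ hφ)
      have h2 := polyLE_mono (Nat.le_succ n) (ih _ hφ')
      convert sub_mem h1 h2 using 1
      funext x
      simp only [Pi.sub_apply, Pi.mul_apply]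
      have hc : Continuous f := continuous_of_mem_polyLE hf
      rw [← integral_const_mul, ← integral_sub ((integrable_conv hc hφ x).const_mul _)
        (integrable_conv hc hφ' x)]
      refine integral_congr_ae (Filter.Eventually.of_forall fun ξ => ?_)
      simp only [coord, PiLp.sub_apply, Complex.ofReal_sub]
      ring

/-- The restriction of polynomials to the sphere. -/
def polyToL2 (d n : ℕ) : polyLE d n →ₗ[ℂ] L2S d :=
  (ContinuousMap.toLp 2 (surf d) ℂ : C(S d, ℂ) →L[ℂ] L2S d).toLinearMap ∘ₗ
    { toFun := fun f => (⟨fun η => f.1 η,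
        (continuous_of_mem_polyLE f.2).comp continuous_subtype_val⟩ : C(S d, ℂ))
      map_add' := fun _ _ => rfl
      map_smul' := fun _ _ => rfl }

/-- The integral makes sense for every `x` in `ℝ^d` and is there a polynomial, by `conv_mem_polyLE`;
the image is its restriction to the sphere. -/
lemma range_sphereConv_le {n : ℕ} (k : C(E d, ℂ)) (hk : (k : E d → ℂ) ∈ polyLE d n) :
    LinearMap.range (sphereConv k : L2S d →ₗ[ℂ] L2S d) ≤ LinearMap.range (polyToL2 d n) := by
  rintro _ ⟨φ, rfl⟩
  exact ⟨⟨_, conv_mem_polyLE hk (integrable_coe φ)⟩, rfl⟩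

lemma hasGeometricApprox_sphereConv (k : C(E d, ℂ)) {C q : ℝ} {N : ℕ} (hC : 0 ≤ C) (hq0 : 0 < q)
    (hq1 : q < 1) (h : ∀ n : ℕ, ∃ f ∈ polyLE d (n + N),
      ∀ ζ : E d, ‖ζ‖ ≤ 2 → ‖k ζ - f ζ‖ ≤ C * q ^ n) :
    HasGeometricApprox (sphereConv k) := by
  obtain ⟨B, hB0, hB⟩ := exists_norm_sphereConv_le d
  refine ⟨B * C, q, N + d, d, hq0, hq1, fun n => ?_⟩
  obtain ⟨f, hf, hkf⟩ := h n
  let F : C(E d, ℂ) := ⟨f, continuous_of_mem_polyLE hf⟩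
  have hle := range_sphereConv_le F hf
  refine ⟨sphereConv F, Submodule.finiteDimensional_of_le hle, ?_, ?_⟩
  · calc _ ≤ Module.finrank ℂ (LinearMap.range (polyToL2 d (n + N))) := Submodule.finrank_mono hle
      _ ≤ Module.finrank ℂ (polyLE d (n + N)) := LinearMap.finrank_range_le _
      _ ≤ _ := by
        rw [← add_assoc]
        exact finrank_polyLE_le _
  · rw [← sphereConv_sub, mul_assoc]
    exact hB _ _ (by positivity) hkf

/-- Conjugating the approximants by `U` does not increase their ranks or errors; this carries the
property from `L₂(S)` to `ℋ`. -/
lemma HasGeometricApprox.conj {H K : Type*} [NormedAddCommGroup H] [InnerProductSpace ℂ H]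
    [NormedAddCommGroup K] [InnerProductSpace ℂ K] {T : H →L[ℂ] H} (hT : HasGeometricApprox T)
    (U : H ≃ₗᵢ[ℂ] K) :
    HasGeometricApprox ((U : H →L[ℂ] K) ∘L T ∘L (U.symm : K →L[ℂ] H)) := by
  obtain ⟨C, q, c, e, hq0, hq1, h⟩ := hT
  refine ⟨C, q, c, e, hq0, hq1, fun n => ?_⟩
  obtain ⟨F, hF, hrank, hTF⟩ := h n
  have hle : LinearMap.range
      (((U : H →L[ℂ] K) ∘L F ∘L (U.symm : K →L[ℂ] H) : K →L[ℂ] K) : K →ₗ[ℂ] K) ≤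
      (LinearMap.range (F : H →ₗ[ℂ] H)).map (U.toLinearEquiv : H →ₗ[ℂ] K) := by
    rintro _ ⟨x, rfl⟩
    exact ⟨F (U.symm x), ⟨_, rfl⟩, rfl⟩
  refine ⟨(U : H →L[ℂ] K) ∘L F ∘L (U.symm : K →L[ℂ] H), Submodule.finiteDimensional_of_le hle,
    (Submodule.finrank_mono hle).trans ((Submodule.finrank_map_le _ _).trans hrank), ?_⟩
  refine le_trans ?_ hTF
  refine ContinuousLinearMap.opNorm_le_bound _ (norm_nonneg _) fun x => ?_
  have : ((U : H →L[ℂ] K) ∘L T ∘L (U.symm : K →L[ℂ] H) -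
      (U : H →L[ℂ] K) ∘L F ∘L (U.symm : K →L[ℂ] H)) x = U ((T - F) (U.symm x)) := by
    simp
  rw [this, U.norm_map, ← U.symm.norm_map x]
  exact (T - F).le_opNorm _

end Convolution

/-! ### The Toeplitz operator -/

section Toeplitz

variable {d : ℕ}

/-- The kernel `π (2π)^{-d/2} â`. -/
def toeplitzKernel (a : CompactDistribution d) : C(E d, ℂ) :=
  ⟨fun ζ => ((Real.pi / (2 * Real.pi) ^ ((d : ℝ) / 2) : ℝ) : ℂ) * fourierE a ζ,
    continuous_const.mul (contDiff_fourierE a).continuous⟩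

lemma toeplitzKernel_apply (a : CompactDistribution d) (ζ : E d) :
    toeplitzKernel a ζ = ((Real.pi / (2 * Real.pi) ^ ((d : ℝ) / 2) : ℝ) : ℂ) * fourierE a ζ := rfl

/-- The normalizations agree because `π (2π)^{-d/2} (2π)^{-d/2} = c_d²`. -/
lemma toeplitzKernel_eq (a : CompactDistribution d) (ζ : E d) :
    toeplitzKernel a ζ = (cd d : ℂ) ^ 2 * a (Smooth.planeWave ζ) := by
  have h : Real.pi / (2 * Real.pi) ^ ((d : ℝ) / 2) * (2 * Real.pi) ^ (-((d : ℝ) / 2)) =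
      cd d ^ 2 := by
    rw [cd, div_pow, Real.sq_sqrt Real.pi_pos.le, Real.rpow_neg (by positivity)]
    field_simp
  rw [toeplitzKernel_apply, fourierE, ← mul_assoc, ← Complex.ofReal_mul, h, Complex.ofReal_pow]

lemma conj_herglotzFun (ψ : S d → ℂ) (x : E d) :
    conj (herglotzFun ψ x) = (cd d : ℂ) *
      ∫ η : S d, conj (ψ η) * Complex.exp (-Complex.I * (inner ℝ x (η : E d) : ℝ)) ∂(surf d) := by
  rw [herglotzFun, map_mul, Complex.conj_ofReal, ← integral_conj]
  congr 2
  funext η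
  rw [map_mul, ← Complex.exp_conj, map_mul, Complex.conj_I, Complex.conj_ofReal]

lemma integrable_conj_mul (φ ψ : L2S d) :
    Integrable (fun z : S d × S d => conj (ψ z.1) * φ z.2) ((surf d).prod (surf d)) :=
  Integrable.mul_prod ((Complex.conjCLE : ℂ →L[ℝ] ℂ).integrable_comp (integrable_coe ψ))
    (integrable_coe φ)

lemma mulConj_I_apply (φ ψ : L2S d) (x : E d) :
    Smooth.mulConj (Herglotz.I d φ) (Herglotz.I d ψ) x =
      ∫ z : S d × S d, ((cd d : ℂ) ^ 2 * (conj (ψ z.1) * φ z.2)) *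
        Complex.exp (-Complex.I * (inner ℝ x ((z.1 : E d) - z.2) : ℝ))
          ∂((surf d).prod (surf d)) := by
  change herglotzFun φ x * conj (herglotzFun ψ x) = _
  rw [conj_herglotzFun, herglotzFun]
  have : ∀ z : S d × S d, ((cd d : ℂ) ^ 2 * (conj (ψ z.1) * φ z.2)) *
        Complex.exp (-Complex.I * (inner ℝ x ((z.1 : E d) - z.2) : ℝ)) = (cd d : ℂ) ^ 2 *
      ((conj (ψ z.1) * Complex.exp (-Complex.I * (inner ℝ x (z.1 : E d) : ℝ))) *
        (φ z.2 * Complex.exp (Complex.I * (inner ℝ x (z.2 : E d) : ℝ)))) := by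
    intro z
    have hexp : Complex.exp (-Complex.I * (inner ℝ x ((z.1 : E d) - z.2) : ℝ)) =
        Complex.exp (-Complex.I * (inner ℝ x (z.1 : E d) : ℝ)) *
          Complex.exp (Complex.I * (inner ℝ x (z.2 : E d) : ℝ)) := by
      rw [← Complex.exp_add, inner_sub_right]
      congr 1
      push_cast
      ring
    rw [hexp]
    ring
  simp_rw [this]
  rw [integral_const_mul, integral_prod_mul
    (fun η : S d => conj (ψ η) * Complex.exp (-Complex.I * (inner ℝ x (η : E d) : ℝ)))
    (fun ξ : S d => φ ξ * Complex.exp (Complex.I * (inner ℝ x (ξ : E d) : ℝ)))]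
  ring

/-- The form `F_a(I φ, I ψ)` as an integral over two copies of the sphere. -/
lemma toeplitzForm_I (a : CompactDistribution d) (φ ψ : L2S d) :
    toeplitzForm a (Herglotz.I d φ) (Herglotz.I d ψ) =
      ∫ z : S d × S d, (conj (ψ z.1) * φ z.2) * toeplitzKernel a ((z.1 : E d) - z.2)
        ∂((surf d).prod (surf d)) := by
  have hval : MeasurableEmbedding (Subtype.val : S d → E d) :=
    MeasurableEmbedding.subtype_coe Metric.isClosed_sphere.measurableSet
  -- Superpositions are indexed by a normed space, so the product measure is pushed forward to `E d
  -- × E d` and the weight is extended by zero. In the sup norm every `ι z` has norm `1`, so all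
  -- moments reduce to integrability of `w₀`.
  let ι : S d × S d → E d × E d := Prod.map Subtype.val Subtype.val
  have hemb : MeasurableEmbedding ι := hval.prodMap hval
  let w₀ : S d × S d → ℂ := fun z => (cd d : ℂ) ^ 2 * (conj (ψ z.1) * φ z.2)
  have hw₀ : Integrable w₀ ((surf d).prod (surf d)) := (integrable_conj_mul φ ψ).const_mul _
  let w : E d × E d → ℂ := Function.extend ι w₀ 0
  have hw : ∀ z, w (ι z) = w₀ z := fun z => hemb.injective.extend_apply _ _ z
  let p : E d × E d →L[ℝ] E d := ContinuousLinearMap.fst ℝ _ _ - ContinuousLinearMap.snd ℝ _ _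
  have hp : ∀ z : S d × S d, p (ι z) = (z.1 : E d) - z.2 := fun z => rfl
  have hwint : ∀ n : ℕ, Integrable (fun v => ‖v‖ ^ n * ‖w v‖)
      (((surf d).prod (surf d)).map ι) := by
    intro n
    rw [hemb.integrable_map_iff]
    refine hw₀.norm.congr (Filter.Eventually.of_forall fun z => ?_)
    have : ‖ι z‖ = 1 := by
      rw [Prod.norm_def]
      change max ‖(z.1 : E d)‖ ‖(z.2 : E d)‖ = 1
      rw [norm_eq_of_mem_sphere, norm_eq_of_mem_sphere, max_self]
    simp [hw, this]
  have hwm : AEStronglyMeasurable w (((surf d).prod (surf d)).map ι) := by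
    rw [hemb.aestronglyMeasurable_map_iff]
    exact hw₀.aestronglyMeasurable.congr (Filter.Eventually.of_forall fun z => (hw z).symm)
  rw [toeplitzForm, a.apply_integral_wave p hwint hwm]
  · rw [hemb.integral_map]
    refine integral_congr_ae (Filter.Eventually.of_forall fun z => ?_)
    simp only [hw, hp, toeplitzKernel_eq, w₀]
    ring
  · intro x
    rw [mulConj_I_apply, hemb.integral_map]
    simp only [hw, hp, w₀]

/-- Fubini's theorem: integrating first over `ξ` in the double integral of `toeplitzForm_I` produces
the integral operator. -/
lemma inner_sphereConv (a : CompactDistribution d) (φ ψ : L2S d) :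
    inner ℂ ψ (sphereConv (toeplitzKernel a) φ) =
      toeplitzForm a (Herglotz.I d φ) (Herglotz.I d ψ) := by
  have hint : Integrable (fun z : S d × S d =>
      (conj (ψ z.1) * φ z.2) * toeplitzKernel a ((z.1 : E d) - z.2)) ((surf d).prod (surf d)) := by
    let g : C(S d × S d, ℂ) := ⟨fun z => toeplitzKernel a ((z.1 : E d) - z.2), by fun_prop⟩
    exact (integrable_conj_mul φ ψ).mul_bdd (c := ‖g‖) g.continuous.aestronglyMeasurable
      (Filter.Eventually.of_forall fun z => g.norm_coe_le_norm z)
  rw [toeplitzForm_I, integral_prod _ hint, L2.inner_def]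
  refine integral_congr_ae ?_
  filter_upwards [sphereConv_ae (toeplitzKernel a) φ] with η hη
  rw [hη, RCLike.inner_apply, mul_comm, ← integral_const_mul]
  congr 1
  funext ξ
  ring

/-- The Toeplitz operator with symbol `a`. -/
def toeplitzOp (a : CompactDistribution d) : Herglotz d →L[ℂ] Herglotz d :=
  (Herglotz.I d : L2S d →L[ℂ] Herglotz d) ∘L sphereConv (toeplitzKernel a) ∘L
    ((Herglotz.I d).symm : Herglotz d →L[ℂ] L2S d)

lemma isToeplitz_toeplitzOp (a : CompactDistribution d) : IsToeplitz a (toeplitzOp a) := by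
  intro u v
  obtain ⟨φ, rfl⟩ := (Herglotz.I d).surjective u
  obtain ⟨ψ, rfl⟩ := (Herglotz.I d).surjective v
  rw [← inner_sphereConv, ← (Herglotz.I d).inner_map_map]
  simp [toeplitzOp]

lemma IsToeplitz.eq_toeplitzOp {a : CompactDistribution d} {T : Herglotz d →L[ℂ] Herglotz d}
    (hT : IsToeplitz a T) : T = toeplitzOp a := by
  ext1 u
  refine ext_inner_left ℂ fun v => ?_
  rw [hT u v, isToeplitz_toeplitzOp a u v]

lemma hasGeometricApprox_toeplitzOp (a : CompactDistribution d) :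
    HasGeometricApprox (toeplitzOp a) := by
  -- The radius `2` covers all differences `η - ξ` of points of the sphere.
  obtain ⟨C, q, N, hC, hq0, hq1, h⟩ := exists_poly_approx_fourierE a 2
  set c : ℂ := ((Real.pi / (2 * Real.pi) ^ ((d : ℝ) / 2) : ℝ) : ℂ) with hc
  refine HasGeometricApprox.conj (hasGeometricApprox_sphereConv (C := ‖c‖ * C) (N := N) _
    (by positivity) hq0 hq1 fun n => ?_) (Herglotz.I d)
  obtain ⟨f, hf, hle⟩ := h n
  refine ⟨c • f, Submodule.smul_mem _ c hf, fun ζ hζ => ?_⟩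
  rw [toeplitzKernel_apply, Pi.smul_apply, smul_eq_mul, ← mul_sub, norm_mul, mul_assoc]
  gcongr
  exact hle ζ hζ

end Toeplitz

end Helmholtz

end

theorem proposition8p6 (d : ℕ) (hd : 2 ≤ d) (a : Helmholtz.CompactDistribution d) :
    -- the Toeplitz operator with symbol `a` exists, as a bounded operator, and is unique
    (∃! T : Helmholtz.Herglotz d →L[ℂ] Helmholtz.Herglotz d, Helmholtz.IsToeplitz a T) ∧
    ∀ T : Helmholtz.Herglotz d →L[ℂ] Helmholtz.Herglotz d, Helmholtz.IsToeplitz a T →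
      -- it is compact and belongs to all Schatten classes
      IsCompactOperator T ∧
      (∀ p : ℝ, 0 < p → Helmholtz.IsSchatten p T) ∧
      -- on the sphere it is an integral operator with smooth kernel
      ContDiff ℝ ∞ (Helmholtz.fourierE a) ∧
      ∀ φ : Helmholtz.L2S d,
        ∀ᵐ η ∂(Helmholtz.surf d),
          (Helmholtz.Herglotz.I d).symm (T (Helmholtz.Herglotz.I d φ)) η =
            ((Real.pi / (2 * Real.pi) ^ ((d : ℝ) / 2) : ℝ) : ℂ) *
              ∫ ξ : Helmholtz.S d,
                Helmholtz.fourierE a ((η : Helmholtz.E d) - ξ) * φ ξ ∂(Helmholtz.surf d) := by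
  refine ⟨⟨Helmholtz.toeplitzOp a, Helmholtz.isToeplitz_toeplitzOp a,
    fun T hT => Helmholtz.IsToeplitz.eq_toeplitzOp hT⟩, fun T hT => ?_⟩
  obtain rfl := Helmholtz.IsToeplitz.eq_toeplitzOp hT
  have hgeo := Helmholtz.hasGeometricApprox_toeplitzOp a
  refine ⟨hgeo.isCompactOperator, fun p hp => hgeo.isSchatten hp,
    Helmholtz.contDiff_fourierE a, fun φ => ?_⟩
  filter_upwards [Helmholtz.sphereConv_ae (Helmholtz.toeplitzKernel a) φ] with η hη
  have h1 : (Helmholtz.Herglotz.I d).symm (Helmholtz.toeplitzOp a (Helmholtz.Herglotz.I d φ)) =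
      Helmholtz.sphereConv (Helmholtz.toeplitzKernel a) φ := by
    simp [Helmholtz.toeplitzOp]
  rw [h1, hη, ← integral_const_mul]
  simp only [Helmholtz.toeplitzKernel_apply, mul_assoc]
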